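/- Let $G=(V,E)$ be a finite simple undirected graph with $n\ge 1$ vertices. A *Customizable Hub Labeling* (CuHL) of $G$ is a map $L\colon V\to 2^V$ such that for all $s,t\in V$ (including $s=t$) and every $s$-$t$-path $P$ in $G$, the set $L(s)\cap L(t)$ contains a vertex of $P$. It is *hierarchical* (an HCuHL) if there is a bijection $\pi\colon V\to\{1,\dots,n\}$ such that $u\in L(v)$ implies $\pi(u)\ge\pi(v)$. The average label size of $L$ is $L_{\mathrm{avg}}=\frac1n\sum_{v\in V}|L(v)|$. A $\sqrt n\times\sqrt n$ grid graph is a graph isomorphic to the Cartesian product of two paths with $k=\sqrt n\ge 1$ vertices each. **Lemma.** There is an algorithm that, given any $\sqrt n\times\sqrt n$ grid graph $G$ (by its number of vertices and its adjacency matrix, with the vertices numbered arbitrarily), computes in time polynomial in $n$ an HCuHL of $G$ whose average label size is at most $$\frac{3}{\frac14\cdot\sqrt{2/3}}\approx 14.7$$ times the average label size of any CuHL of $G$, and at most $$\frac{3}{\frac23\cdot\sqrt{2/3}}\approx 5.5$$ times the average label size of any HCuHL of $G$. -/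

import Mathlib

namespace CuHL

/-- Customizable cover property: for all vertices `s`, `t` (also `s = t`) and every `s`-`t`-path `P`,
the set `L s ∩ L t` contains a vertex of `P`. -/
def IsCuHL {V : Type*} (G : SimpleGraph V) (L : V → Finset V) : Prop :=
  ∀ (s t : V) (P : G.Walk s t), P.IsPath → ∃ w ∈ P.support, w ∈ L s ∧ w ∈ L t

/-- `L` respects the vertex order `π`: a label only contains vertices of at least the same rank. -/
def Respects {V : Type*} [Fintype V] (L : V → Finset V) (π : V ≃ Fin (Fintype.card V)) : Prop :=
  ∀ u v : V, u ∈ L v → π v ≤ π u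

/-- A hierarchical customizable hub labeling. -/
def IsHCuHL {V : Type*} [Fintype V] (G : SimpleGraph V) (L : V → Finset V) : Prop :=
  IsCuHL G L ∧ ∃ π : V ≃ Fin (Fintype.card V), Respects L π

/-- The average label size of a labeling. -/
noncomputable def avgLabelSize {V : Type*} [Fintype V] (L : V → Finset V) : ℝ :=
  (∑ v, ((L v).card : ℝ)) / Fintype.card V

/-- The `k × k` grid: `(i, j)` and `(i', j')` are adjacent iff they agree in one coordinate and
differ by exactly one in the other. -/
def gridGraph (k : ℕ) : SimpleGraph (Fin k × Fin k) :=
  (SimpleGraph.pathGraph k).boxProd (SimpleGraph.pathGraph k)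

/-- `G` is a `√n × √n` grid graph, where `n` is its number of vertices and the vertices may be
numbered in any way. -/
def IsSquareGrid {V : Type*} (G : SimpleGraph V) : Prop :=
  ∃ k : ℕ, Nonempty (G ≃g gridGraph k)

/-! The machine model: a random access machine in structured form. A program uses finitely many
variables and finitely many two-dimensional arrays, all holding natural numbers. Every operation
(access to a variable or an array cell, addition, truncated subtraction, halving, comparison,
assignment, test) costs one step. As there is no multiplication, the bit lengths of the numbers grow
by at most a constant per step, so that polynomial time is the same notion as for Turing machines. -/

/-- The contents of the memory. -/
structure Store where
  /-- the value of each variable -/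
  var : ℕ → ℕ
  /-- the entry of array `a` at row `i` and column `j` is `arr a i j` -/
  arr : ℕ → ℕ → ℕ → ℕ

/-- Expressions; comparisons have the values `1` (true) and `0` (false). -/
inductive Expr where
  | const (c : ℕ)
  | var (x : ℕ)
  | get (a : ℕ) (i j : Expr)
  | add (e f : Expr)
  | sub (e f : Expr)
  | half (e : Expr)
  | lt (e f : Expr)
  | eq (e f : Expr)

/-- The value of an expression. -/
def Expr.eval (σ : Store) : Expr → ℕ
  | .const c => c
  | .var x => σ.var x
  | .get a i j => σ.arr a (i.eval σ) (j.eval σ)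
  | .add e f => e.eval σ + f.eval σ
  | .sub e f => e.eval σ - f.eval σ
  | .half e => e.eval σ / 2
  | .lt e f => if e.eval σ < f.eval σ then 1 else 0
  | .eq e f => if e.eval σ = f.eval σ then 1 else 0

/-- The number of steps for the evaluation of an expression. -/
def Expr.cost : Expr → ℕ
  | .const _ => 1
  | .var _ => 1
  | .get _ i j => i.cost + j.cost + 1
  | .add e f => e.cost + f.cost + 1
  | .sub e f => e.cost + f.cost + 1
  | .half e => e.cost + 1
  | .lt e f => e.cost + f.cost + 1
  | .eq e f => e.cost + f.cost + 1

/-- Programs. -/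
inductive Prog where
  | skip
  | assign (x : ℕ) (e : Expr)
  | store (a : ℕ) (i j e : Expr)
  | seq (p q : Prog)
  | ite (e : Expr) (p q : Prog)
  | loop (e : Expr) (p : Prog)

/-- The store after the assignment of `m` to the variable `x`. -/
def Store.setVar (σ : Store) (x m : ℕ) : Store :=
  { σ with var := fun y => if y = x then m else σ.var y }

/-- The store after the assignment of `m` to the entry `(i, j)` of the array `a`. -/
def Store.setArr (σ : Store) (a i j m : ℕ) : Store :=
  { σ with arr := fun b i' j' => if b = a ∧ i' = i ∧ j' = j then m else σ.arr b i' j' }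

/-- `Run p σ t τ`: started in the store `σ`, the program `p` halts after exactly `t` steps in the
store `τ`. The statement `loop e p` repeats `p` as long as `e` is not `0`. -/
inductive Run : Prog → Store → ℕ → Store → Prop where
  | skip (σ : Store) : Run .skip σ 1 σ
  | assign (σ : Store) (x : ℕ) (e : Expr) :
      Run (.assign x e) σ (e.cost + 1) (σ.setVar x (e.eval σ))
  | store (σ : Store) (a : ℕ) (i j e : Expr) :
      Run (.store a i j e) σ (i.cost + j.cost + e.cost + 1)
        (σ.setArr a (i.eval σ) (j.eval σ) (e.eval σ))
  | seq {σ τ ρ : Store} {p q : Prog} {t u : ℕ} :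
      Run p σ t τ → Run q τ u ρ → Run (.seq p q) σ (t + u) ρ
  | iteTrue {σ τ : Store} {e : Expr} {p q : Prog} {t : ℕ} :
      e.eval σ ≠ 0 → Run p σ t τ → Run (.ite e p q) σ (e.cost + 1 + t) τ
  | iteFalse {σ τ : Store} {e : Expr} {p q : Prog} {t : ℕ} :
      e.eval σ = 0 → Run q σ t τ → Run (.ite e p q) σ (e.cost + 1 + t) τ
  | loopDone {σ : Store} {e : Expr} {p : Prog} :
      e.eval σ = 0 → Run (.loop e p) σ (e.cost + 1) σ
  | loopStep {σ τ ρ : Store} {e : Expr} {p : Prog} {t u : ℕ} :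
      e.eval σ ≠ 0 → Run p σ t τ → Run (.loop e p) τ u ρ →
        Run (.loop e p) σ (e.cost + 1 + t + u) ρ

open Classical in
/-- The input: variable `0` holds the number of vertices and array `0` holds the adjacency matrix
of `G`; everything else is `0`. -/
noncomputable def inputStore {n : ℕ} (G : SimpleGraph (Fin n)) : Store where
  var := fun x => if x = 0 then n else 0
  arr := fun a i j =>
    if a = 0 ∧ ∃ (hi : i < n) (hj : j < n), G.Adj ⟨i, hi⟩ ⟨j, hj⟩ then 1 else 0

/-- The output: `u` is in the label of `v` iff the entry of array `1` in row `v` and column `u`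
is not `0`. -/
def outputLabeling (n : ℕ) (σ : Store) : Fin n → Finset (Fin n) :=
  fun v => Finset.univ.filter fun u : Fin n => σ.arr 1 v u ≠ 0

end CuHL

/-!
Let `L` be a customizable hub labeling of the `k × k` grid. If `L s` has fewer than `k` vertices,
then some row and some column avoid it, and they connect `s` to `t` outside `L s ∩ L t`, unless both
lines through `s` meet `L t` or both lines through `t` meet `L s`. A set `A` meets both lines of at
most `|A|²` vertices. So if `S` consists of the vertices whose labels are smaller than
`√(2/3) · k`, double counting gives `|S|² ≤ 2 ∑ |L v|²`, the sum being over `v ∈ S`, and hence the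
labels have at least `(2/3) · √(2/3) · k` vertices on average.

Conversely, dissect the grid by its middle column, each half by its middle row, and so on. A vertex
has its hubs on the separators of the rectangles that contain it. Two rounds halve both sides of the
rectangle, so that these separators have at most `k + k/2 + k/2 + k/4 + k/4 + ⋯ ≤ 3 * k` vertices.

To carry this out on a grid with unknown numbering, one needs coordinates. If `p` and `q` are the
two ends of a side, then `d(v, p) + d(v, q) - (k - 1)` is twice the distance from `v` to this side,
and `d(v, p)` minus this distance is the position of `v` along it. Corners are the vertices that
have some vertex at distance `2 * k - 2`. All this takes only loops over the vertices, nested to a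
fixed depth, and hence polynomial time.
-/

namespace CuHL

section LowerBound

variable {V W : Type*} {G : SimpleGraph V} {H : SimpleGraph W}

/-- `a` and `b` are joined by a walk that avoids `S`; a customizable hub labeling must never leave
two vertices joined outside the intersection of their labels. -/
def JoinedOutside (G : SimpleGraph V) (S : Set V) (a b : V) : Prop :=
  ∃ w : G.Walk a b, ∀ v ∈ w.support, v ∉ S

theorem JoinedOutside.trans {S : Set V} {a b c : V} (hab : JoinedOutside G S a b)
    (hbc : JoinedOutside G S b c) : JoinedOutside G S a c := by
  obtain ⟨w, hw⟩ := hab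
  obtain ⟨w', hw'⟩ := hbc
  refine ⟨w.append w', fun v hv => ?_⟩
  exact ((w.mem_support_append_iff w').1 hv).elim (hw v) (hw' v)

theorem joinedOutside_map {S : Set W} (f : G →g H) (hf : ∀ v, f v ∉ S) {a b : V}
    (hab : G.Reachable a b) : JoinedOutside H S (f a) (f b) := by
  obtain ⟨w⟩ := hab
  refine ⟨w.map f, fun v hv => ?_⟩
  rw [SimpleGraph.Walk.support_map] at hv
  obtain ⟨i, -, rfl⟩ := List.mem_map.1 hv
  exact hf i

theorem IsCuHL.not_joinedOutside {L : V → Finset V} (hL : IsCuHL G L) (s t : V) :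
    ¬ JoinedOutside G {v | v ∈ L s ∧ v ∈ L t} s t := by
  classical
  rintro ⟨w, hw⟩
  obtain ⟨v, hv, hvL⟩ := hL s t w.bypass w.bypass_isPath
  exact hw v (w.support_bypass_subset_support hv) hvL

variable {k : ℕ}

theorem joinedOutside_row {S : Set (Fin k × Fin k)} {j : Fin k} (hj : ∀ i, (i, j) ∉ S)
    (a b : Fin k) : JoinedOutside (gridGraph k) S (a, j) (b, j) :=
  joinedOutside_map (SimpleGraph.boxProdLeft _ (SimpleGraph.pathGraph k) j).toHom hj
    (SimpleGraph.pathGraph_preconnected k a b)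

theorem joinedOutside_col {S : Set (Fin k × Fin k)} {i : Fin k} (hi : ∀ j, (i, j) ∉ S)
    (a b : Fin k) : JoinedOutside (gridGraph k) S (i, a) (i, b) :=
  joinedOutside_map (SimpleGraph.boxProdRight (SimpleGraph.pathGraph k) _ i).toHom hi
    (SimpleGraph.pathGraph_preconnected k a b)

theorem exists_forall_mem_ne_of_card_lt {α β : Type*} [Fintype β] {A : Finset α}
    (hA : A.card < Fintype.card β) (f : α → β) : ∃ b, ∀ a ∈ A, f a ≠ b := by
  classical
  obtain ⟨b, -, hb⟩ := Finset.exists_mem_notMem_of_card_lt_card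
    (Finset.card_image_le.trans_lt hA : (A.image f).card < Finset.univ.card)
  exact ⟨b, fun a ha hab => hb (hab ▸ Finset.mem_image_of_mem f ha)⟩

/-- The vertices of the grid both of whose lines, the row and the column, meet `A`. -/
def shadow (A : Finset (Fin k × Fin k)) : Finset (Fin k × Fin k) :=
  A.image Prod.fst ×ˢ A.image Prod.snd

theorem card_shadow_le (A : Finset (Fin k × Fin k)) : (shadow A).card ≤ A.card ^ 2 := by
  rw [shadow, Finset.card_product, sq]
  exact Nat.mul_le_mul Finset.card_image_le Finset.card_image_le

theorem col_free_or_row_free_of_notMem_shadow {A : Finset (Fin k × Fin k)} {v : Fin k × Fin k}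
    (hv : v ∉ shadow A) : (∀ j, (v.1, j) ∉ A) ∨ ∀ i, (i, v.2) ∉ A := by
  by_contra! hmeet
  obtain ⟨⟨j, hj⟩, i, hi⟩ := hmeet
  exact hv (Finset.mem_product.2
    ⟨Finset.mem_image.2 ⟨_, hj, rfl⟩, Finset.mem_image.2 ⟨_, hi, rfl⟩⟩)

theorem IsCuHL.mem_shadow_or_mem_shadow {L : Fin k × Fin k → Finset (Fin k × Fin k)}
    (hL : IsCuHL (gridGraph k) L) {s t : Fin k × Fin k} (hs : (L s).card < k) :
    s ∈ shadow (L t) ∨ t ∈ shadow (L s) := by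
  by_contra! hnot
  refine hL.not_joinedOutside s t ?_
  obtain ⟨s₁, s₂⟩ := s
  obtain ⟨t₁, t₂⟩ := t
  have hcard : (L (s₁, s₂)).card < Fintype.card (Fin k) := by rwa [Fintype.card_fin]
  obtain ⟨i, hi⟩ := exists_forall_mem_ne_of_card_lt hcard Prod.fst
  obtain ⟨j, hj⟩ := exists_forall_mem_ne_of_card_lt hcard Prod.snd
  rcases col_free_or_row_free_of_notMem_shadow hnot.1 with hs' | hs' <;>
    rcases col_free_or_row_free_of_notMem_shadow hnot.2 with ht' | ht'
  · exact (joinedOutside_col (fun _ h => hs' _ h.2) s₂ j).trans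
      ((joinedOutside_row (fun _ h => hj _ h.1 rfl) s₁ t₁).trans
        (joinedOutside_col (fun _ h => ht' _ h.1) j t₂))
  · exact (joinedOutside_col (fun _ h => hs' _ h.2) s₂ t₂).trans
      (joinedOutside_row (fun _ h => ht' _ h.1) s₁ t₁)
  · exact (joinedOutside_row (fun _ h => hs' _ h.2) s₁ t₁).trans
      (joinedOutside_col (fun _ h => ht' _ h.1) s₂ t₂)
  · exact (joinedOutside_row (fun _ h => hs' _ h.2) s₁ i).trans
      ((joinedOutside_col (fun _ h => hi _ h.1 rfl) s₂ t₂).trans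
        (joinedOutside_row (fun _ h => ht' _ h.1) i t₁))

theorem sq_card_le_two_mul_sum_card {α : Type*} {A : Finset α} {N : α → Finset α}
    (hN : ∀ s ∈ A, ∀ t ∈ A, s ∈ N t ∨ t ∈ N s) : A.card ^ 2 ≤ 2 * ∑ t ∈ A, (N t).card := by
  classical
  have hcover : A ×ˢ A ⊆ (A.sigma N).image (fun x => (x.2, x.1)) ∪
      (A.sigma N).image (fun x => (x.1, x.2)) := by
    rintro ⟨s, t⟩ hst
    obtain ⟨hs, ht⟩ := Finset.mem_product.1 hst
    refine Finset.mem_union.2 ((hN s hs t ht).imp (fun h => ?_) fun h => ?_)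
    · exact Finset.mem_image.2 ⟨⟨t, s⟩, Finset.mem_sigma.2 ⟨ht, h⟩, rfl⟩
    · exact Finset.mem_image.2 ⟨⟨s, t⟩, Finset.mem_sigma.2 ⟨hs, h⟩, rfl⟩
  calc A.card ^ 2 = (A ×ˢ A).card := by rw [Finset.card_product, sq]
    _ ≤ (A.sigma N).card + (A.sigma N).card :=
      (Finset.card_le_card hcover).trans <| (Finset.card_union_le _ _).trans <|
        Nat.add_le_add Finset.card_image_le Finset.card_image_le
    _ = 2 * ∑ t ∈ A, (N t).card := by rw [Finset.card_sigma, two_mul]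

theorem mul_card_sub_le_sum_of_sq_card_le {ι : Type*} [Fintype ι] {f : ι → ℝ} {t : ℝ}
    (hf : ∀ i, 0 ≤ f i) (ht : 0 < t) {A : Finset ι} (hA : ∀ i, i ∈ A ↔ f i < t)
    (hsq : (A.card : ℝ) ^ 2 ≤ 2 * ∑ i ∈ A, f i ^ 2) :
    t * Fintype.card ι - t ^ 3 / 2 ≤ ∑ i, f i := by
  classical
  have hsmall : ∑ i ∈ A, f i ^ 2 ≤ t * ∑ i ∈ A, f i := by
    rw [Finset.mul_sum]
    refine Finset.sum_le_sum fun i hi => ?_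
    rw [sq]
    exact mul_le_mul_of_nonneg_right ((hA i).1 hi).le (hf i)
  have hlarge : (Aᶜ.card : ℝ) * t ≤ ∑ i ∈ Aᶜ, f i := by
    rw [← nsmul_eq_mul]
    refine Finset.card_nsmul_le_sum _ _ _ fun i hi => ?_
    exact not_lt.1 fun hlt => Finset.mem_compl.1 hi ((hA i).2 hlt)
  have hcard : (A.card : ℝ) + Aᶜ.card = Fintype.card ι := by exact_mod_cast A.card_add_card_compl
  rw [← hcard, ← Finset.sum_add_sum_compl A]
  -- The sum over `A` is at least `(#A)² / (2 * t)`, and `(#A - t²)² ≥ 0`.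
  have hA_le : t * A.card - t ^ 3 / 2 ≤ ∑ i ∈ A, f i := by
    refine le_of_mul_le_mul_left ?_ ht
    nlinarith [sq_nonneg ((A.card : ℝ) - t ^ 2)]
  linarith

theorem IsCuHL.mul_cube_le_sum_card {L : Fin k × Fin k → Finset (Fin k × Fin k)}
    (hL : IsCuHL (gridGraph k) L) (hk : 0 < k) :
    (2 / 3) * √(2 / 3) * k ^ 3 ≤ ∑ v, ((L v).card : ℝ) := by
  have hsqrt : √(2 / 3) ^ 2 = (2 / 3 : ℝ) := Real.sq_sqrt (by norm_num)
  have hk' : (0 : ℝ) < k := Nat.cast_pos.2 hk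
  have hsqrt_lt_one : √(2 / 3 : ℝ) < 1 := (Real.sqrt_lt' one_pos).2 (by norm_num)
  set A := Finset.univ.filter fun v => ((L v).card : ℝ) < √(2 / 3) * k
  have hA (v) : v ∈ A ↔ ((L v).card : ℝ) < √(2 / 3) * k := by simp [A]
  have hA_lt (v) (hv : v ∈ A) : (L v).card < k := by
    exact_mod_cast ((hA v).1 hv).trans (mul_lt_of_lt_one_left hk' hsqrt_lt_one)
  have hsq : A.card ^ 2 ≤ 2 * ∑ v ∈ A, (L v).card ^ 2 :=
    (sq_card_le_two_mul_sum_card fun s hs t _ =>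
      hL.mem_shadow_or_mem_shadow (t := t) (hA_lt s hs)).trans <|
      Nat.mul_le_mul_left 2 <| Finset.sum_le_sum fun v _ => card_shadow_le (L v)
  refine le_of_eq_of_le ?_ (mul_card_sub_le_sum_of_sq_card_le (fun v => Nat.cast_nonneg _)
    (mul_pos (Real.sqrt_pos.2 (by norm_num)) hk') hA (by exact_mod_cast hsq))
  rw [Fintype.card_prod, Fintype.card_fin]
  push_cast
  linear_combination (√(2 / 3) * k ^ 3 / 2 : ℝ) * hsqrt

/-- The labeling of `W` that corresponds to the labeling `L` of `V` under a bijection. -/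
def transport (e : V ≃ W) (L : V → Finset V) (w : W) : Finset W :=
  (L (e.symm w)).map e.toEmbedding

theorem mem_transport {e : V ≃ W} {L : V → Finset V} {u w : W} :
    u ∈ transport e L w ↔ e.symm u ∈ L (e.symm w) :=
  Finset.mem_map_equiv

theorem IsCuHL.transport {L : V → Finset V} (hL : IsCuHL G L) (φ : G ≃g H) :
    IsCuHL H (transport φ.toEquiv L) := by
  intro s t P hP
  obtain ⟨w, hw, hs, ht⟩ := hL _ _ (P.map φ.symm.toHom) (hP.map φ.symm.injective)
  rw [SimpleGraph.Walk.support_map] at hw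
  obtain ⟨v, hv, rfl⟩ := List.mem_map.1 hw
  exact ⟨v, hv, mem_transport.2 hs, mem_transport.2 ht⟩

theorem avgLabelSize_transport [Fintype V] [Fintype W] (e : V ≃ W) (L : V → Finset V) :
    avgLabelSize (transport e L) = avgLabelSize L := by
  simp only [avgLabelSize, transport, Finset.card_map, Fintype.card_congr e]
  rw [e.symm.sum_comp fun v => ((L v).card : ℝ)]

theorem IsCuHL.le_avgLabelSize [Fintype V] {L : V → Finset V} (hL : IsCuHL G L)
    (φ : G ≃g gridGraph k) : (2 / 3) * √(2 / 3) * k ≤ avgLabelSize L := by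
  rcases k.eq_zero_or_pos with rfl | hk
  · rw [Nat.cast_zero, mul_zero]
    exact div_nonneg (Finset.sum_nonneg fun v _ => Nat.cast_nonneg _) (Nat.cast_nonneg _)
  have hk' : (0 : ℝ) < k := Nat.cast_pos.2 hk
  rw [← avgLabelSize_transport φ.toEquiv, avgLabelSize, Fintype.card_prod, Fintype.card_fin,
    Nat.cast_mul, le_div_iff₀ (mul_pos hk' hk')]
  calc (2 / 3) * √(2 / 3) * k * (k * k) = (2 / 3) * √(2 / 3) * (k : ℝ) ^ 3 := by ring
    _ ≤ _ := (hL.transport φ).mul_cube_le_sum_card hk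

end LowerBound

section NestedDissection

theorem IsCuHL.isHCuHL_of_trans_of_antisymm {V : Type*} [Fintype V] {G : SimpleGraph V}
    {L : V → Finset V} (hL : IsCuHL G L)
    (htrans : ∀ {u v w}, v ∈ L u → w ∈ L v → w ∈ L u)
    (hantisymm : ∀ {u v}, v ∈ L u → u ∈ L v → u = v) : IsHCuHL G L := by
  have hrefl (v : V) : v ∈ L v := by
    obtain ⟨w, hw, hwL, -⟩ := hL v v .nil .nil
    rwa [SimpleGraph.Walk.mem_support_nil_iff.1 hw] at hwL
  let _ : PartialOrder V :=
    { le u v := v ∈ L u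
      le_refl := hrefl
      le_trans _ _ _ := htrans
      le_antisymm _ _ := hantisymm }
  let _ : Fintype (LinearExtension V) := inferInstanceAs (Fintype V)
  let rank := (Fintype.orderIsoFinOfCardEq (LinearExtension V) rfl).symm
  exact ⟨hL, rank.toEquiv, fun u v huv => rank.monotone (toLinearExtension.monotone huv)⟩

/-- `u` is a hub of `v` in the nested dissection of the rectangle `[a, b) × [c, d)`. The middle
column `(a + b) / 2` separates the rectangle, and on it the second coordinate decides. The two sides
are dissected with the coordinates exchanged, so that the separators are alternately columns and
rows. -/
inductive IsHub : (a b c d : ℕ) → (v u : ℕ × ℕ) → Prop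
  | separator {a b c d : ℕ} {v u : ℕ × ℕ} (hv₁ : v.1 ∈ Set.Ico a b) (hv₂ : v.2 ∈ Set.Ico c d)
      (hu : u.1 = (a + b) / 2) (hle : v.1 = u.1 → v.2 ≤ u.2) : IsHub a b c d v u
  | left {a b c d : ℕ} {v u : ℕ × ℕ} (hu : u.1 < (a + b) / 2)
      (h : IsHub c d a ((a + b) / 2) v.swap u.swap) : IsHub a b c d v u
  | right {a b c d : ℕ} {v u : ℕ × ℕ} (hu : (a + b) / 2 < u.1)
      (h : IsHub c d ((a + b) / 2 + 1) b v.swap u.swap) : IsHub a b c d v u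

variable {a b c d : ℕ} {v u w : ℕ × ℕ}

theorem isHub_iff_of_eq_mid (hu : u.1 = (a + b) / 2) : IsHub a b c d v u ↔
    (v.1 ∈ Set.Ico a b ∧ v.2 ∈ Set.Ico c d) ∧ (v.1 = u.1 → v.2 ≤ u.2) := by
  refine ⟨fun h => ?_, fun h => .separator h.1.1 h.1.2 hu h.2⟩
  cases h with
  | separator hv₁ hv₂ _ hle => exact ⟨⟨hv₁, hv₂⟩, hle⟩
  | left hu' => exact absurd hu hu'.ne
  | right hu' => exact absurd hu hu'.ne'

theorem isHub_iff_of_lt_mid (hu : u.1 < (a + b) / 2) :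
    IsHub a b c d v u ↔ IsHub c d a ((a + b) / 2) v.swap u.swap := by
  refine ⟨fun h => ?_, .left hu⟩
  cases h with
  | separator _ _ hu' => exact absurd hu' hu.ne
  | left _ h => exact h
  | right hu' => exact absurd hu hu'.not_gt

theorem isHub_iff_of_mid_lt (hu : (a + b) / 2 < u.1) :
    IsHub a b c d v u ↔ IsHub c d ((a + b) / 2 + 1) b v.swap u.swap := by
  refine ⟨fun h => ?_, .right hu⟩
  cases h with
  | separator _ _ hu' => exact absurd hu' hu.ne'
  | left hu' => exact absurd hu hu'.not_gt
  | right _ h => exact h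

theorem IsHub.mem_Ico (h : IsHub a b c d v u) : v.1 ∈ Set.Ico a b ∧ v.2 ∈ Set.Ico c d := by
  induction h with
  | separator hv₁ hv₂ => exact ⟨hv₁, hv₂⟩
  | left _ _ ih =>
    simp only [Prod.fst_swap, Prod.snd_swap, Set.mem_Ico] at ih ⊢
    omega
  | right _ _ ih =>
    simp only [Prod.fst_swap, Prod.snd_swap, Set.mem_Ico] at ih ⊢
    omega

theorem IsHub.trans (hvu : IsHub a b c d v u) (huw : IsHub a b c d u w) : IsHub a b c d v w := by
  induction huw generalizing v with
  | @separator a b c d u w _ _ hw hle =>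
    refine .separator hvu.mem_Ico.1 hvu.mem_Ico.2 hw fun hvw => ?_
    rcases lt_trichotomy u.1 ((a + b) / 2) with hu | hu | hu
    · have := ((isHub_iff_of_lt_mid hu).1 hvu).mem_Ico.2.2
      exact absurd (hvw.trans hw) this.ne
    · exact (((isHub_iff_of_eq_mid hu).1 hvu).2 (by omega)).trans (hle (by omega))
    · have := ((isHub_iff_of_mid_lt hu).1 hvu).mem_Ico.2.1
      exact absurd (hvw.trans hw) (Nat.lt_of_succ_le this).ne'
  | left hw huw ih =>
    exact .left hw (ih ((isHub_iff_of_lt_mid huw.mem_Ico.2.2).1 hvu))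
  | right hw huw ih =>
    exact .right hw (ih ((isHub_iff_of_mid_lt huw.mem_Ico.2.1).1 hvu))

theorem IsHub.antisymm (hvu : IsHub a b c d v u) (huv : IsHub a b c d u v) : v = u := by
  induction huv with
  | @separator a b c d u v _ _ hv hle =>
    rcases lt_trichotomy u.1 ((a + b) / 2) with hu | hu | hu
    · exact absurd hv ((isHub_iff_of_lt_mid hu).1 hvu).mem_Ico.2.2.ne
    · have hvu₁ : v.1 = u.1 := hv.trans hu.symm
      exact Prod.ext hvu₁ (le_antisymm (((isHub_iff_of_eq_mid hu).1 hvu).2 hvu₁) (hle hvu₁.symm))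
    · exact absurd hv (Nat.lt_of_succ_le ((isHub_iff_of_mid_lt hu).1 hvu).mem_Ico.2.1).ne'
  | left _ huv ih =>
    exact Prod.swap_injective (ih ((isHub_iff_of_lt_mid huv.mem_Ico.2.2).1 hvu))
  | right _ huv ih =>
    exact Prod.swap_injective (ih ((isHub_iff_of_mid_lt huv.mem_Ico.2.1).1 hvu))

theorem exists_forall_isHub_of_mem_mid {W : Finset (ℕ × ℕ)}
    (hrect : ∀ w ∈ W, w.1 ∈ Set.Ico a b ∧ w.2 ∈ Set.Ico c d)
    (hmid : ∃ w ∈ W, w.1 = (a + b) / 2) : ∃ w ∈ W, ∀ v ∈ W, IsHub a b c d v w := by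
  obtain ⟨w, hw, hmax⟩ := (W.filter (·.1 = (a + b) / 2)).exists_max_image Prod.snd
    (hmid.imp fun w hw => Finset.mem_filter.2 hw)
  obtain ⟨hwW, hwm⟩ := Finset.mem_filter.1 hw
  exact ⟨w, hwW, fun v hv => .separator (hrect v hv).1 (hrect v hv).2 hwm fun hvw =>
    hmax v (Finset.mem_filter.2 ⟨hv, hvw.trans hwm⟩)⟩

theorem exists_forall_isHub (a b c d : ℕ) {W : Finset (ℕ × ℕ)} (hW : W.Nonempty)
    (hrect : ∀ w ∈ W, w.1 ∈ Set.Ico a b ∧ w.2 ∈ Set.Ico c d)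
    (hfst : (Prod.fst '' (W : Set (ℕ × ℕ))).OrdConnected)
    (hsnd : (Prod.snd '' (W : Set (ℕ × ℕ))).OrdConnected) :
    ∃ w ∈ W, ∀ v ∈ W, IsHub a b c d v w := by
  by_cases hmid : ∃ w ∈ W, w.1 = (a + b) / 2
  · exact exists_forall_isHub_of_mem_mid hrect hmid
  push Not at hmid
  have hside {v w : ℕ × ℕ} (hv : v ∈ W) (hw : w ∈ W) (hvm : v.1 < (a + b) / 2) :
      w.1 < (a + b) / 2 := by
    by_contra! hwm
    obtain ⟨u, hu, hum⟩ := hfst.out ⟨v, hv, rfl⟩ ⟨w, hw, rfl⟩ ⟨hvm.le, hwm⟩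
    exact hmid u hu hum
  have hfst' : (Prod.fst '' (W.image Prod.swap : Set (ℕ × ℕ))).OrdConnected := by
    simpa [Set.image_image] using hsnd
  have hsnd' : (Prod.snd '' (W.image Prod.swap : Set (ℕ × ℕ))).OrdConnected := by
    simpa [Set.image_image] using hfst
  have hrect_swap {a' b'} (h : ∀ w ∈ W, w.1 ∈ Set.Ico a' b') :
      ∀ w ∈ W.image Prod.swap, w.1 ∈ Set.Ico c d ∧ w.2 ∈ Set.Ico a' b' :=
    Finset.forall_mem_image.2 fun w hw => ⟨(hrect w hw).2, h w hw⟩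
  have hW' := hW.image Prod.swap
  obtain ⟨w₀, hw₀⟩ := hW
  have := Set.mem_Ico.1 (hrect w₀ hw₀).1
  rcases (hmid w₀ hw₀).lt_or_gt with hlt | hgt
  · obtain ⟨w', hw', hhub⟩ := exists_forall_isHub c d a ((a + b) / 2) hW'
      (hrect_swap fun w hw => ⟨(hrect w hw).1.1, hside hw₀ hw hlt⟩) hfst' hsnd'
    obtain ⟨w, hw, rfl⟩ := Finset.mem_image.1 hw'
    exact ⟨w, hw, fun v hv => .left (hside hw₀ hw hlt) (hhub _ (Finset.mem_image_of_mem _ hv))⟩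
  · have hgt' (w) (hw : w ∈ W) : (a + b) / 2 < w.1 :=
      (hmid w hw).lt_or_gt.resolve_left fun h => (hside hw hw₀ h).not_gt hgt
    obtain ⟨w', hw', hhub⟩ := exists_forall_isHub c d ((a + b) / 2 + 1) b hW'
      (hrect_swap fun w hw => ⟨hgt' w hw, (hrect w hw).1.2⟩) hfst' hsnd'
    obtain ⟨w, hw, rfl⟩ := Finset.mem_image.1 hw'
    exact ⟨w, hw, fun v hv => .right (hgt' w hw) (hhub _ (Finset.mem_image_of_mem _ hv))⟩
termination_by b - a + (d - c)

open Classical in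
theorem card_filter_isHub_le_add {a' b' m : ℕ}
    (h : ∀ u, u.1 ∈ Set.Ico a b → IsHub a b c d v u →
      u.1 = m ∨ u.1 ∈ Set.Ico a' b' ∧ IsHub c d a' b' v.swap u.swap) :
    ((Finset.Ico a b ×ˢ Finset.Ico c d).filter (IsHub a b c d v)).card ≤ (d - c) +
      ((Finset.Ico c d ×ˢ Finset.Ico a' b').filter (IsHub c d a' b' v.swap)).card := by
  have hsub : (Finset.Ico a b ×ˢ Finset.Ico c d).filter (IsHub a b c d v) ⊆
      {m} ×ˢ Finset.Ico c d ∪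
        ((Finset.Ico c d ×ˢ Finset.Ico a' b').filter (IsHub c d a' b' v.swap)).image Prod.swap := by
    intro u hu
    simp only [Finset.mem_filter, Finset.mem_product, Finset.mem_Ico] at hu
    obtain ⟨⟨hu₁, hu₂⟩, hub⟩ := hu
    refine Finset.mem_union.2 ((h u hu₁ hub).imp (fun hum => ?_) fun hu' => ?_)
    · exact Finset.mem_product.2 ⟨Finset.mem_singleton.2 hum, Finset.mem_Ico.2 hu₂⟩
    · refine Finset.mem_image.2 ⟨u.swap, Finset.mem_filter.2 ⟨?_, hu'.2⟩, u.swap_swap⟩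
      exact Finset.mem_product.2 ⟨Finset.mem_Ico.2 hu₂, Finset.mem_Ico.2 hu'.1⟩
  refine (Finset.card_le_card hsub).trans ((Finset.card_union_le _ _).trans ?_)
  refine Nat.add_le_add ?_ Finset.card_image_le
  rw [Finset.card_product, Finset.card_singleton, one_mul, Nat.card_Ico]

open Classical in
theorem card_filter_isHub_le (a b c d : ℕ) (v : ℕ × ℕ) :
    ((Finset.Ico a b ×ˢ Finset.Ico c d).filter (IsHub a b c d v)).card ≤ 2 * (d - c) + (b - a) := by
  by_cases hv : v.1 ∈ Set.Ico a b
  · obtain ⟨hav, hvb⟩ := Set.mem_Ico.1 hv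
    rcases lt_or_ge v.1 ((a + b) / 2) with hlt | hge
    · have hleft := card_filter_isHub_le_add (a := a) (b := b) (c := c) (d := d) (v := v) (a' := a)
        (b' := (a + b) / 2) fun u hu hub => by
          rcases lt_trichotomy u.1 ((a + b) / 2) with hum | hum | hum
          · exact .inr ⟨⟨hu.1, hum⟩, (isHub_iff_of_lt_mid hum).1 hub⟩
          · exact .inl hum
          · have hmv := ((isHub_iff_of_mid_lt hum).1 hub).mem_Ico.2.1
            exact absurd hlt (Nat.lt_of_succ_le hmv).not_gt
      have ih := card_filter_isHub_le c d a ((a + b) / 2) v.swap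
      omega
    · have hright := card_filter_isHub_le_add (a := a) (b := b) (c := c) (d := d) (v := v)
        (a' := (a + b) / 2 + 1) (b' := b) fun u hu hub => by
          rcases lt_trichotomy u.1 ((a + b) / 2) with hum | hum | hum
          · exact absurd ((isHub_iff_of_lt_mid hum).1 hub).mem_Ico.2.2 hge.not_gt
          · exact .inl hum
          · exact .inr ⟨⟨hum, hu.2⟩, (isHub_iff_of_mid_lt hum).1 hub⟩
      have ih := card_filter_isHub_le c d ((a + b) / 2 + 1) b v.swap
      omega
  · rw [Finset.filter_false_of_mem fun u _ h => hv h.mem_Ico.1]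
    exact Nat.zero_le _
termination_by b - a + (d - c)

theorem ordConnected_image_support {V : Type*} {G : SimpleGraph V} {x : V → ℕ}
    (hx : ∀ u v, G.Adj u v → x u ≤ x v + 1) {s t : V} (P : G.Walk s t) :
    (x '' {w | w ∈ P.support}).OrdConnected := by
  induction P with
  | nil => simpa using Set.ordConnected_singleton
  | @cons u v w huv P ih =>
    have hv : x v ∈ x '' {w | w ∈ P.support} := ⟨v, P.start_mem_support, rfl⟩
    have huv₁ := hx u v huv
    have huv₂ := hx v u huv.symm
    have hset : x '' {w | w ∈ (SimpleGraph.Walk.cons huv P).support} =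
        insert (x u) (x '' {w | w ∈ P.support}) := by
      rw [← Set.image_insert_eq]
      simp [Set.insert_def]
    rw [hset]
    refine ⟨?_⟩
    rintro y (rfl | hy) z (rfl | hz) r ⟨hyr, hrz⟩
    · exact .inl (le_antisymm hrz hyr)
    · refine hyr.eq_or_lt.imp Eq.symm fun hlt => ih.out hv hz ⟨by omega, hrz⟩
    · refine hrz.eq_or_lt.imp id fun hlt => ih.out hy hv ⟨hyr, by omega⟩
    · exact .inr (ih.out hy hz ⟨hyr, hrz⟩)

variable {V : Type*} [Fintype V]

open Classical in
/-- The labeling by nested dissection of the square `[0, k) × [0, k)`, in which `coord v` is the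
position of `v`. -/
noncomputable def dissectionLabeling (k : ℕ) (coord : V → ℕ × ℕ) (v : V) : Finset V :=
  {u | IsHub 0 k 0 k (coord v) (coord u)}

variable {k : ℕ} {coord : V → ℕ × ℕ}

theorem mem_dissectionLabeling {u v : V} :
    u ∈ dissectionLabeling k coord v ↔ IsHub 0 k 0 k (coord v) (coord u) := by
  simp [dissectionLabeling]

theorem isHCuHL_dissectionLabeling {G : SimpleGraph V} (hinj : coord.Injective)
    (hlt : ∀ v, (coord v).1 < k ∧ (coord v).2 < k)
    (hfst : ∀ u v, G.Adj u v → (coord u).1 ≤ (coord v).1 + 1)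
    (hsnd : ∀ u v, G.Adj u v → (coord u).2 ≤ (coord v).2 + 1) :
    IsHCuHL G (dissectionLabeling k coord) := by
  classical
  have hcover : IsCuHL G (dissectionLabeling k coord) := by
    intro s t P _
    obtain ⟨w, hw, hhub⟩ := exists_forall_isHub 0 k 0 k (W := P.support.toFinset.image coord)
      ⟨_, Finset.mem_image_of_mem coord (List.mem_toFinset.2 P.start_mem_support)⟩
      (Finset.forall_mem_image.2 fun v _ => by simpa using hlt v)
      (by simpa [Set.image_image] using ordConnected_image_support hfst P)
      (by simpa [Set.image_image] using ordConnected_image_support hsnd P)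
    obtain ⟨u, hu, rfl⟩ := Finset.mem_image.1 hw
    have hmem {v} (hv : v ∈ P.support) : u ∈ dissectionLabeling k coord v :=
      mem_dissectionLabeling.2 (hhub _ (Finset.mem_image_of_mem coord (List.mem_toFinset.2 hv)))
    exact ⟨u, List.mem_toFinset.1 hu, hmem P.start_mem_support, hmem P.end_mem_support⟩
  refine hcover.isHCuHL_of_trans_of_antisymm (fun huv hvw => ?_) fun huv hvu => ?_
  · rw [mem_dissectionLabeling] at huv hvw ⊢
    exact huv.trans hvw
  · rw [mem_dissectionLabeling] at huv hvu
    exact hinj (huv.antisymm hvu)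

theorem card_dissectionLabeling_le (hinj : coord.Injective)
    (hlt : ∀ v, (coord v).1 < k ∧ (coord v).2 < k) (v : V) :
    (dissectionLabeling k coord v).card ≤ 3 * k := by
  classical
  calc (dissectionLabeling k coord v).card
      = ((dissectionLabeling k coord v).image coord).card :=
        (Finset.card_image_of_injective _ hinj).symm
    _ ≤ ((Finset.Ico 0 k ×ˢ Finset.Ico 0 k).filter (IsHub 0 k 0 k (coord v))).card := by
        refine Finset.card_le_card (Finset.image_subset_iff.2 fun u hu => ?_)
        simpa [hlt u] using mem_dissectionLabeling.1 hu
    _ ≤ 2 * (k - 0) + (k - 0) := card_filter_isHub_le 0 k 0 k (coord v)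
    _ = 3 * k := by omega

theorem avgLabelSize_dissectionLabeling_le (hinj : coord.Injective)
    (hlt : ∀ v, (coord v).1 < k ∧ (coord v).2 < k) :
    avgLabelSize (dissectionLabeling k coord) ≤ 3 * k := by
  refine div_le_of_le_mul₀ (Nat.cast_nonneg _) (by positivity) ?_
  rw [mul_comm, ← nsmul_eq_mul]
  exact Finset.sum_le_card_nsmul _ _ _ fun v _ => by
    exact_mod_cast card_dissectionLabeling_le hinj hlt v

end NestedDissection

section Coordinates

variable {V W : Type*} {G : SimpleGraph V} {H : SimpleGraph W}

theorem le_add_length_of_walk {x : V → ℕ} (hx : ∀ u v, G.Adj u v → x u ≤ x v + 1) {s t : V}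
    (P : G.Walk s t) : x s ≤ x t + P.length := by
  induction P with
  | nil => exact le_rfl
  | cons huv P ih =>
    rw [SimpleGraph.Walk.length_cons]
    have := hx _ _ huv
    omega

theorem le_add_dist_of_reachable {x : V → ℕ} (hx : ∀ u v, G.Adj u v → x u ≤ x v + 1) {s t : V}
    (hst : G.Reachable s t) : x s ≤ x t + G.dist s t := by
  obtain ⟨P, hP⟩ := hst.exists_walk_length_eq_dist
  exact hP ▸ le_add_length_of_walk hx P

theorem dist_le_dist_add_one_of_adj (hG : G.Preconnected) {u v : V} (huv : G.Adj u v) (p : V) :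
    G.dist p u ≤ G.dist p v + 1 := by
  rw [← SimpleGraph.dist_eq_one_iff_adj.2 huv.symm]
  exact (hG p v).dist_triangle_left u

theorem dist_apply_le_of_reachable (f : G →g H) {s t : V} (hst : G.Reachable s t) :
    H.dist (f s) (f t) ≤ G.dist s t := by
  obtain ⟨P, hP⟩ := hst.exists_walk_length_eq_dist
  rw [← hP, ← P.length_map f]
  exact SimpleGraph.dist_le _

theorem dist_apply_iso (φ : G ≃g H) {s t : V} (hst : G.Reachable s t) :
    H.dist (φ s) (φ t) = G.dist s t :=
  le_antisymm (dist_apply_le_of_reachable φ.toHom hst) <| by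
    simpa using dist_apply_le_of_reachable φ.symm.toHom (hst.map φ.toHom)

variable {k : ℕ}

theorem pathGraph_dist_le_sub {i j : Fin k} (hij : (i : ℕ) ≤ j) :
    (SimpleGraph.pathGraph k).dist i j ≤ j - i := by
  obtain ⟨m, hm⟩ := Nat.exists_eq_add_of_le hij
  rw [hm, Nat.add_sub_cancel_left]
  clear hij
  induction m generalizing j with
  | zero => rw [Fin.ext hm, SimpleGraph.dist_self]
  | succ m ih =>
    let j' : Fin k := ⟨i + m, by omega⟩
    have hadj : (SimpleGraph.pathGraph k).Adj j j' :=
      SimpleGraph.pathGraph_adj.2 (.inr (by simp only [j']; omega))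
    exact (dist_le_dist_add_one_of_adj (SimpleGraph.pathGraph_preconnected k) hadj i).trans
      (Nat.add_le_add_right (ih (j := j') rfl) 1)

theorem pathGraph_dist (i j : Fin k) :
    (SimpleGraph.pathGraph k).dist i j = (i - j : ℕ) + (j - i) := by
  have hval (a b : Fin k) (hab : (SimpleGraph.pathGraph k).Adj a b) : (a : ℕ) ≤ b + 1 := by
    rw [SimpleGraph.pathGraph_adj] at hab
    omega
  have hij := le_add_dist_of_reachable hval (SimpleGraph.pathGraph_preconnected k i j)
  have hji := le_add_dist_of_reachable hval (SimpleGraph.pathGraph_preconnected k j i)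
  have hcomm := SimpleGraph.dist_comm (G := SimpleGraph.pathGraph k) (u := i) (v := j)
  rcases le_total (i : ℕ) j with h | h
  · have := pathGraph_dist_le_sub h
    omega
  · have := pathGraph_dist_le_sub h
    omega

theorem gridGraph_preconnected (k : ℕ) : (gridGraph k).Preconnected :=
  (SimpleGraph.pathGraph_preconnected k).boxProd (SimpleGraph.pathGraph_preconnected k)

theorem gridGraph_dist (u v : Fin k × Fin k) : (gridGraph k).dist u v =
    (SimpleGraph.pathGraph k).dist u.1 v.1 + (SimpleGraph.pathGraph k).dist u.2 v.2 := by
  have hpath := SimpleGraph.pathGraph_preconnected k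
  rw [← Nat.cast_inj (R := ℕ∞), Nat.cast_add, (gridGraph_preconnected k u v).coe_dist_eq_edist,
    (hpath u.1 v.1).coe_dist_eq_edist, (hpath u.2 v.2).coe_dist_eq_edist]
  exact SimpleGraph.edist_boxProd u v

/-- `p` is a corner of the `k × k` grid `G`: a vertex at the largest possible distance `2 * (k - 1)`
from some other vertex. -/
def IsCorner (G : SimpleGraph V) (k : ℕ) (p : V) : Prop :=
  ∃ w, G.dist p w + 2 = k + k

/-- `p` and `q` are the two ends of a side of the `k × k` grid `G`. -/
def IsSide (G : SimpleGraph V) (k : ℕ) (p q : V) : Prop :=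
  IsCorner G k p ∧ IsCorner G k q ∧ G.dist p q + 1 = k

theorem isCorner_gridGraph_iff {p : Fin k × Fin k} : IsCorner (gridGraph k) k p ↔
    ((p.1 : ℕ) = 0 ∨ (p.1 : ℕ) + 1 = k) ∧ ((p.2 : ℕ) = 0 ∨ (p.2 : ℕ) + 1 = k) := by
  constructor
  · rintro ⟨w, hw⟩
    rw [gridGraph_dist, pathGraph_dist, pathGraph_dist] at hw
    omega
  · intro hp
    refine ⟨(p.1.rev, p.2.rev), ?_⟩
    rw [gridGraph_dist, pathGraph_dist, pathGraph_dist, Fin.val_rev, Fin.val_rev]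
    omega

theorem IsCorner.apply_iso {p : V} (hp : IsCorner G k p) (hG : G.Preconnected) (φ : G ≃g H) :
    IsCorner H k (φ p) := by
  obtain ⟨w, hw⟩ := hp
  exact ⟨φ w, (dist_apply_iso φ (hG p w)).symm ▸ hw⟩

theorem IsSide.apply_iso {p q : V} (hpq : IsSide G k p q) (hG : G.Preconnected) (φ : G ≃g H) :
    IsSide H k (φ p) (φ q) :=
  ⟨hpq.1.apply_iso hG φ, hpq.2.1.apply_iso hG φ, (dist_apply_iso φ (hG p q)).symm ▸ hpq.2.2⟩

theorem exists_isSide (φ : G ≃g gridGraph k) (hk : 0 < k) : ∃ p q, IsSide G k p q := by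
  let p : Fin k × Fin k := (⟨0, hk⟩, ⟨0, hk⟩)
  let q : Fin k × Fin k := (⟨k - 1, by omega⟩, ⟨0, hk⟩)
  have hpq : IsSide (gridGraph k) k p q := by
    refine ⟨isCorner_gridGraph_iff.2 ?_, isCorner_gridGraph_iff.2 ?_, ?_⟩
    · simp [p]
    · simp [q, Nat.sub_add_cancel hk]
    · rw [gridGraph_dist, pathGraph_dist, pathGraph_dist]
      simp [p, q, Nat.sub_add_cancel hk]
  exact ⟨_, _, hpq.apply_iso (gridGraph_preconnected k) φ.symm⟩

/-- The position in the `k × k` grid of a vertex at distance `d` from the corner `(0, 0)` and at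
distance `e` from the corner `(k - 1, 0)`. -/
def gridCoord (k d e : ℕ) : ℕ × ℕ :=
  ((d + (k - 1) - e) / 2, (d + e - (k - 1)) / 2)

theorem gridCoord_add {d d' e : ℕ} (h : d + d' + 1 = k) :
    gridCoord k (d + e) (d' + e) = (d, e) := by
  rw [gridCoord, Prod.mk.injEq]
  omega

theorem pathGraph_dist_add_dist {i j : Fin k} (hij : (SimpleGraph.pathGraph k).dist i j + 1 = k)
    (l : Fin k) :
    (SimpleGraph.pathGraph k).dist i l + (SimpleGraph.pathGraph k).dist j l + 1 = k := by
  rw [pathGraph_dist] at hij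
  rw [pathGraph_dist, pathGraph_dist]
  omega

theorem IsSide.eq_and_dist_or {p q : Fin k × Fin k} (hpq : IsSide (gridGraph k) k p q) :
    (p.2 = q.2 ∧ (SimpleGraph.pathGraph k).dist p.1 q.1 + 1 = k) ∨
      p.1 = q.1 ∧ (SimpleGraph.pathGraph k).dist p.2 q.2 + 1 = k := by
  obtain ⟨hp, hq, hdist⟩ := hpq
  rw [isCorner_gridGraph_iff] at hp hq
  rw [gridGraph_dist] at hdist
  simp only [Fin.ext_iff, pathGraph_dist] at hdist ⊢
  omega

theorem gridCoord_gridGraph {p q : Fin k × Fin k} (hpq : IsSide (gridGraph k) k p q) :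
    (∀ v, gridCoord k ((gridGraph k).dist p v) ((gridGraph k).dist q v) =
      ((SimpleGraph.pathGraph k).dist p.1 v.1, (SimpleGraph.pathGraph k).dist p.2 v.2)) ∨
    ∀ v, gridCoord k ((gridGraph k).dist p v) ((gridGraph k).dist q v) =
      ((SimpleGraph.pathGraph k).dist p.2 v.2, (SimpleGraph.pathGraph k).dist p.1 v.1) := by
  refine hpq.eq_and_dist_or.imp (fun ⟨heq, hdist⟩ v => ?_) fun ⟨heq, hdist⟩ v => ?_
  · rw [gridGraph_dist, gridGraph_dist, ← heq]
    exact gridCoord_add (pathGraph_dist_add_dist hdist v.1)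
  · rw [gridGraph_dist, gridGraph_dist, ← heq, add_comm, add_comm (SimpleGraph.dist _ p.1 _)]
    exact gridCoord_add (pathGraph_dist_add_dist hdist v.2)

theorem gridCoord_gridGraph_lt {p q : Fin k × Fin k} (hpq : IsSide (gridGraph k) k p q)
    (v : Fin k × Fin k) :
    (gridCoord k ((gridGraph k).dist p v) ((gridGraph k).dist q v)).1 < k ∧
      (gridCoord k ((gridGraph k).dist p v) ((gridGraph k).dist q v)).2 < k := by
  rcases gridCoord_gridGraph hpq with h | h <;> simp only [h, pathGraph_dist] <;> omega

theorem gridCoord_gridGraph_injective {p q : Fin k × Fin k} (hpq : IsSide (gridGraph k) k p q) :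
    (fun v => gridCoord k ((gridGraph k).dist p v) ((gridGraph k).dist q v)).Injective := by
  have hp := isCorner_gridGraph_iff.1 hpq.1
  intro v w hvw
  suffices (v.1 : ℕ) = w.1 ∧ (v.2 : ℕ) = w.2 from Prod.ext (Fin.ext this.1) (Fin.ext this.2)
  rcases gridCoord_gridGraph hpq with h | h <;>
    simp only [h, pathGraph_dist, Prod.mk.injEq] at hvw <;> omega

/-- The position of each vertex in the grid `G` when the side `p q` is placed on the first axis. -/
noncomputable def sideCoord (G : SimpleGraph V) (k : ℕ) (p q v : V) : ℕ × ℕ :=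
  gridCoord k (G.dist p v) (G.dist q v)

variable {p q : V}

theorem sideCoord_eq_gridGraph (φ : G ≃g gridGraph k) (hG : G.Preconnected) (v : V) :
    sideCoord G k p q v =
      gridCoord k ((gridGraph k).dist (φ p) (φ v)) ((gridGraph k).dist (φ q) (φ v)) := by
  rw [sideCoord, dist_apply_iso φ (hG p v), dist_apply_iso φ (hG q v)]

theorem sideCoord_lt (φ : G ≃g gridGraph k) (hG : G.Preconnected) (hpq : IsSide G k p q) (v : V) :
    (sideCoord G k p q v).1 < k ∧ (sideCoord G k p q v).2 < k := by
  rw [sideCoord_eq_gridGraph φ hG]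
  exact gridCoord_gridGraph_lt (hpq.apply_iso hG φ) (φ v)

theorem sideCoord_injective (φ : G ≃g gridGraph k) (hG : G.Preconnected) (hpq : IsSide G k p q) :
    (sideCoord G k p q).Injective := by
  simp only [Function.Injective, sideCoord_eq_gridGraph φ hG]
  exact (gridCoord_gridGraph_injective (hpq.apply_iso hG φ)).comp φ.injective

theorem sideCoord_le_of_adj (hG : G.Preconnected) {u v : V} (huv : G.Adj u v) :
    (sideCoord G k p q u).1 ≤ (sideCoord G k p q v).1 + 1 ∧
      (sideCoord G k p q u).2 ≤ (sideCoord G k p q v).2 + 1 := by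
  have hpu := dist_le_dist_add_one_of_adj hG huv p
  have hqu := dist_le_dist_add_one_of_adj hG huv q
  have hqv := dist_le_dist_add_one_of_adj hG huv.symm q
  simp only [sideCoord, gridCoord]
  omega

theorem isHCuHL_dissectionLabeling_sideCoord [Fintype V] (φ : G ≃g gridGraph k)
    (hG : G.Preconnected) (hpq : IsSide G k p q) :
    IsHCuHL G (dissectionLabeling k (sideCoord G k p q)) :=
  isHCuHL_dissectionLabeling (sideCoord_injective φ hG hpq) (sideCoord_lt φ hG hpq)
    (fun _ _ huv => (sideCoord_le_of_adj hG huv).1) fun _ _ huv => (sideCoord_le_of_adj hG huv).2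

theorem avgLabelSize_dissectionLabeling_sideCoord_le [Fintype V] (φ : G ≃g gridGraph k)
    (hG : G.Preconnected) (hpq : IsSide G k p q) {L : V → Finset V} (hL : IsCuHL G L) :
    avgLabelSize (dissectionLabeling k (sideCoord G k p q)) ≤
      3 / ((2 / 3) * √(2 / 3)) * avgLabelSize L := by
  have hratio : (3 * k : ℝ) = 3 / ((2 / 3) * √(2 / 3)) * ((2 / 3) * √(2 / 3) * k) := by
    have : √(2 / 3 : ℝ) ≠ 0 := (Real.sqrt_pos.2 (by norm_num)).ne'
    field_simp
  calc avgLabelSize (dissectionLabeling k (sideCoord G k p q)) ≤ 3 * k :=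
        avgLabelSize_dissectionLabeling_le (sideCoord_injective φ hG hpq) (sideCoord_lt φ hG hpq)
    _ = _ := hratio
    _ ≤ _ := mul_le_mul_of_nonneg_left (hL.le_avgLabelSize φ) (by positivity)

end Coordinates

section ForPrograms

namespace Expr

/-- Negation: `1` if `e` has the value `0`, and `0` otherwise. -/
def not (e : Expr) : Expr :=
  .eq e (.const 0)

/-- Conjunction of two conditions, where a condition holds if its value is not `0`. -/
def and (e f : Expr) : Expr :=
  .not (.add e.not f.not)

variable {σ : Store} {e f : Expr}

theorem eval_lt_ne_zero : (lt e f).eval σ ≠ 0 ↔ e.eval σ < f.eval σ := by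
  simp [eval]

theorem eval_eq_ne_zero : (eq e f).eval σ ≠ 0 ↔ e.eval σ = f.eval σ := by
  simp [eval]

theorem eval_not_ne_zero : (not e).eval σ ≠ 0 ↔ e.eval σ = 0 :=
  eval_eq_ne_zero

theorem eval_and_ne_zero : (and e f).eval σ ≠ 0 ↔ e.eval σ ≠ 0 ∧ f.eval σ ≠ 0 := by
  have hnot (g : Expr) : g.not.eval σ = 0 ↔ g.eval σ ≠ 0 :=
    (not_iff_comm.1 eval_not_ne_zero).symm
  rw [and, eval_not_ne_zero, eval, Nat.add_eq_zero_iff, hnot, hnot]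

end Expr

/-- Programs whose only loops are `for` loops over the numbers below the value of the
variable `0`, that is over the vertices of the input graph. They run in polynomial time. -/
inductive ForProg where
  | assign (x : ℕ) (e : Expr)
  | store (a : ℕ) (i j e : Expr)
  | seq (p q : ForProg)
  | ifThen (e : Expr) (p : ForProg)
  | forAll (x : ℕ) (p : ForProg)

namespace Store

variable {σ : Store}

theorem setVar_var_self (x m : ℕ) : (σ.setVar x m).var x = m :=
  if_pos rfl

theorem setVar_var_of_ne {x y : ℕ} (h : y ≠ x) (m : ℕ) : (σ.setVar x m).var y = σ.var y :=
  if_neg h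

theorem setArr_arr_self (a i j m i' j' : ℕ) : (σ.setArr a i j m).arr a i' j' =
    if i' = i ∧ j' = j then m else σ.arr a i' j' := by
  simp [setArr]

theorem setArr_arr_of_ne {a b : ℕ} (h : b ≠ a) (i j m : ℕ) :
    (σ.setArr a i j m).arr b = σ.arr b := by
  simp [setArr, h]

end Store

namespace ForProg

/-- The translation into the programs of the machine model. -/
def toProg : ForProg → Prog
  | assign x e => .assign x e
  | store a i j e => .store a i j e
  | seq p q => .seq p.toProg q.toProg
  | ifThen e p => .ite e p.toProg .skip
  | forAll x p => .seq (.assign x (.const 0)) <| .loop (.lt (.var x) (.var 0)) <|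
      .seq p.toProg (.assign x (.add (.var x) (.const 1)))

/-- The store in which the program halts. -/
def exec : ForProg → Store → Store
  | assign x e, σ => σ.setVar x (e.eval σ)
  | store a i j e, σ => σ.setArr a (i.eval σ) (j.eval σ) (e.eval σ)
  | seq p q, σ => q.exec (p.exec σ)
  | ifThen e p, σ => if e.eval σ ≠ 0 then p.exec σ else σ
  | forAll x p, σ =>
      (fun τ => (p.exec τ).setVar x ((p.exec τ).var x + 1))^[σ.var 0] (σ.setVar x 0)

/-- A bound on the number of steps, as a polynomial in the value of the variable `0`. -/
noncomputable def time : ForProg → Polynomial ℕ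
  | assign _ e => .C (e.cost + 1)
  | store _ i j e => .C (i.cost + j.cost + e.cost + 1)
  | seq p q => p.time + q.time
  | ifThen e p => .C (e.cost + 2) + p.time
  | forAll _ p => (.X + 1) * (p.time + 8)

/-- The variables to which the program may assign a value. -/
def vars : ForProg → Finset ℕ
  | assign x _ => {x}
  | store .. => ∅
  | seq p q => p.vars ∪ q.vars
  | ifThen _ p => p.vars
  | forAll x p => insert x p.vars

/-- The arrays in which the program may store a value. -/
def arrs : ForProg → Finset ℕ
  | assign .. => ∅
  | store a .. => {a}
  | seq p q => p.arrs ∪ q.arrs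
  | ifThen _ p => p.arrs
  | forAll _ p => p.arrs

/-- The stores `σ` and `τ` agree on everything that the program does not write. -/
def Frame (p : ForProg) (σ τ : Store) : Prop :=
  (∀ x ∉ p.vars, τ.var x = σ.var x) ∧ ∀ a ∉ p.arrs, τ.arr a = σ.arr a

/-- The variable `0` is not changed, and neither is the counter of a loop in its body. -/
def Safe : ForProg → Prop
  | assign x _ => x ≠ 0
  | store .. => True
  | seq p q => p.Safe ∧ q.Safe
  | ifThen _ p => p.Safe
  | forAll x p => x ≠ 0 ∧ x ∉ p.vars ∧ p.Safe

instance Safe.instDecidable : (p : ForProg) → Decidable p.Safe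
  | assign x _ => inferInstanceAs (Decidable (x ≠ 0))
  | store .. => .isTrue trivial
  | seq p q =>
    have := Safe.instDecidable p
    have := Safe.instDecidable q
    inferInstanceAs (Decidable (p.Safe ∧ q.Safe))
  | ifThen _ p => Safe.instDecidable p
  | forAll x p =>
    have := Safe.instDecidable p
    inferInstanceAs (Decidable (x ≠ 0 ∧ x ∉ p.vars ∧ p.Safe))

variable {p : ForProg} {x : ℕ}

theorem Frame.refl (p : ForProg) (σ : Store) : p.Frame σ σ :=
  ⟨fun _ _ => rfl, fun _ _ => rfl⟩

theorem Frame.setVar {σ τ : Store} (h : p.Frame σ τ) (hx : x ∈ p.vars) (m : ℕ) :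
    p.Frame σ (τ.setVar x m) := by
  refine ⟨fun y hy => ?_, h.2⟩
  rw [Store.setVar_var_of_ne (ne_of_mem_of_not_mem hx hy).symm, h.1 y hy]

theorem Frame.exec_forAll_body {σ τ : Store} (h : (forAll x p).Frame σ τ)
    (hp : p.Frame τ (p.exec τ)) : (forAll x p).Frame σ (p.exec τ) :=
  ⟨fun y hy => (hp.1 y fun h => hy (Finset.mem_insert_of_mem h)).trans (h.1 y hy),
    fun a ha => (hp.2 a ha).trans (h.2 a ha)⟩

theorem frame_exec (p : ForProg) (σ : Store) : p.Frame σ (p.exec σ) := by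
  induction p generalizing σ with
  | assign x e => exact (Frame.refl _ σ).setVar (Finset.mem_singleton_self x) _
  | store a i j e =>
    exact ⟨fun _ _ => rfl, fun b hb => Store.setArr_arr_of_ne (Finset.notMem_singleton.1 hb) ..⟩
  | seq p q ihp ihq =>
    refine ⟨fun x hx => ?_, fun a ha => ?_⟩
    · have hx' := Finset.notMem_union.1 hx
      exact ((ihq _).1 x hx'.2).trans ((ihp σ).1 x hx'.1)
    · have ha' := Finset.notMem_union.1 ha
      exact ((ihq _).2 a ha'.2).trans ((ihp σ).2 a ha'.1)
  | ifThen e p ih =>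
    simp only [exec]
    split_ifs
    · exact ih σ
    · exact Frame.refl _ σ
  | forAll x p ih =>
    refine Function.Iterate.rec (fun τ => (forAll x p).Frame σ τ) ?_ (fun τ hτ => ?_) _
    · exact (Frame.refl _ σ).setVar (Finset.mem_insert_self x _) _
    · exact (hτ.exec_forAll_body (ih τ)).setVar (Finset.mem_insert_self x _) _

theorem Safe.zero_notMem_vars (hp : p.Safe) : 0 ∉ p.vars := by
  induction p with
  | assign x e => simpa [vars] using hp.symm
  | store a i j e => exact Finset.notMem_empty 0
  | seq p q ihp ihq => exact Finset.notMem_union.2 ⟨ihp hp.1, ihq hp.2⟩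
  | ifThen e p ih => exact ih hp
  | forAll x p ih => exact Finset.mem_insert.not.2 (not_or.2 ⟨hp.1.symm, ih hp.2.2⟩)

theorem exists_run_loop {B : ℕ} (hx : x ≠ 0) (hxp : x ∉ p.vars) (h0p : 0 ∉ p.vars) {n : ℕ}
    (hp : ∀ σ, σ.var 0 = n → ∃ t ≤ B, Run p.toProg σ t (p.exec σ)) {m : ℕ} {σ : Store}
    (hn : σ.var 0 = n) (hm : σ.var x + m = n) :
    ∃ t ≤ m * (B + 8) + 4, Run (.loop (.lt (.var x) (.var 0)) <|
      .seq p.toProg (.assign x (.add (.var x) (.const 1)))) σ t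
      ((fun τ => (p.exec τ).setVar x ((p.exec τ).var x + 1))^[m] σ) := by
  induction m generalizing σ with
  | zero =>
    refine ⟨4, by omega, .loopDone (not_not.1 fun h => ?_)⟩
    have hlt := Expr.eval_lt_ne_zero.1 h
    simp only [Expr.eval] at hlt
    omega
  | succ m ih =>
    obtain ⟨t, ht, hrun⟩ := hp σ hn
    have hvar := (frame_exec p σ).1
    obtain ⟨t', ht', hrun'⟩ := ih (σ := (p.exec σ).setVar x ((p.exec σ).var x + 1))
      (by rw [Store.setVar_var_of_ne hx.symm, hvar 0 h0p, hn])
      (by rw [Store.setVar_var_self, hvar x hxp]; omega)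
    refine ⟨_, ?_, .loopStep ?_ (.seq hrun (.assign _ x _)) hrun'⟩
    · simp only [Expr.cost]
      linarith
    · exact Expr.eval_lt_ne_zero.2 (by simp only [Expr.eval]; omega)

theorem exists_run (hp : p.Safe) (σ : Store) :
    ∃ t ≤ p.time.eval (σ.var 0), Run p.toProg σ t (p.exec σ) := by
  induction p generalizing σ with
  | assign x e => exact ⟨_, by simp [time], .assign σ x e⟩
  | store a i j e => exact ⟨_, by simp [time], .store σ a i j e⟩
  | seq p q ihp ihq =>
    obtain ⟨t, ht, hrun⟩ := ihp hp.1 σ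
    obtain ⟨u, hu, hrun'⟩ := ihq hp.2 (p.exec σ)
    rw [(frame_exec p σ).1 0 hp.1.zero_notMem_vars] at hu
    exact ⟨_, (Nat.add_le_add ht hu).trans_eq Polynomial.eval_add.symm, .seq hrun hrun'⟩
  | ifThen e p ih =>
    obtain ⟨t, ht, hrun⟩ := ih hp σ
    simp only [time, exec, Polynomial.eval_add, Polynomial.eval_C]
    split_ifs with he
    · exact ⟨_, by omega, .iteTrue he hrun⟩
    · exact ⟨_, by omega, .iteFalse (not_not.1 he) (.skip σ)⟩
  | forAll x p ih =>
    obtain ⟨hx, hxp, hp⟩ := hp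
    obtain ⟨t, ht, hrun⟩ := exists_run_loop hx hxp hp.zero_notMem_vars (m := σ.var 0)
      (fun τ hτ => hτ ▸ ih hp τ) (Store.setVar_var_of_ne hx.symm 0)
      (by rw [Store.setVar_var_self, zero_add])
    refine ⟨_, ?_, .seq (.assign σ x _) hrun⟩
    simp only [time, Expr.cost, Polynomial.eval_mul, Polynomial.eval_add, Polynomial.eval_X,
      Polynomial.eval_one, Polynomial.eval_ofNat]
    linarith

theorem exec_forAll_induction (hp : (forAll x p).Safe) {σ : Store} (Inv : ℕ → Store → Prop)
    (h0 : Inv 0 (σ.setVar x 0))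
    (hstep : ∀ i < σ.var 0, ∀ τ, τ.var x = i → (forAll x p).Frame σ τ → Inv i τ →
      Inv (i + 1) ((p.exec τ).setVar x (i + 1))) :
    Inv (σ.var 0) ((forAll x p).exec σ) := by
  suffices ∀ i ≤ σ.var 0, ∀ τ,
      τ = (fun τ => (p.exec τ).setVar x ((p.exec τ).var x + 1))^[i] (σ.setVar x 0) →
      τ.var x = i ∧ (forAll x p).Frame σ τ ∧ Inv i τ from (this _ le_rfl _ rfl).2.2
  intro i hi
  induction i with
  | zero =>
    rintro τ rfl
    exact ⟨Store.setVar_var_self x 0,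
      (Frame.refl _ σ).setVar (Finset.mem_insert_self x _) 0, h0⟩
  | succ i ih =>
    obtain ⟨hx, hframe, hInv⟩ := ih (Nat.le_of_succ_le hi) _ rfl
    rintro τ rfl
    rw [Function.iterate_succ_apply', (frame_exec p _).1 x hp.2.1, hx]
    exact ⟨Store.setVar_var_self x _, (hframe.exec_forAll_body (frame_exec p _)).setVar
      (Finset.mem_insert_self x _) _, hstep i hi _ hx hframe hInv⟩

/-- `p` adds `S` to the set that is represented by the arrays through `M`, without removing
anything from it, and maintains the invariant `I`. -/
def Adds {ι : Type*} (p : ForProg) (I : (ℕ → ℕ → ℕ → ℕ) → Prop) (M : (ℕ → ℕ → ℕ → ℕ) → Set ι)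
    (σ : Store) (S : Set ι) : Prop :=
  I σ.arr → I (p.exec σ).arr ∧ M σ.arr ∪ S ⊆ M (p.exec σ).arr

theorem adds_ifThen {ι : Type*} {e : Expr} {I : (ℕ → ℕ → ℕ → ℕ) → Prop}
    {M : (ℕ → ℕ → ℕ → ℕ) → Set ι} {σ : Store} {S : Set ι} (hp : e.eval σ ≠ 0 → p.Adds I M σ S)
    (hS : I σ.arr → ¬ e.eval σ ≠ 0 → S ⊆ M σ.arr) : (ifThen e p).Adds I M σ S := by
  intro hI
  rw [exec]
  split_ifs with he
  · exact hp he hI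
  · exact ⟨hI, Set.union_subset subset_rfl (hS hI he)⟩

theorem adds_forAll {ι : Type*} {n : ℕ} (hp : (forAll x p).Safe) {σ : Store} (hn : σ.var 0 = n)
    {I : (ℕ → ℕ → ℕ → ℕ) → Prop} {M : (ℕ → ℕ → ℕ → ℕ) → Set ι} {S : Fin n → Set ι}
    (hstep : ∀ (i : Fin n) (τ : Store), τ.var x = i → (forAll x p).Frame σ τ → p.Adds I M τ (S i)) :
    (forAll x p).Adds I M σ (⋃ i, S i) := by
  intro hI
  suffices I ((forAll x p).exec σ).arr ∧ M σ.arr ⊆ M ((forAll x p).exec σ).arr ∧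
      ∀ j : Fin n, (j : ℕ) < σ.var 0 → S j ⊆ M ((forAll x p).exec σ).arr from
    ⟨this.1, Set.union_subset this.2.1 (Set.iUnion_subset fun j => this.2.2 j (hn ▸ j.2))⟩
  refine exec_forAll_induction hp (fun i τ => I τ.arr ∧ M σ.arr ⊆ M τ.arr ∧
    ∀ j : Fin n, (j : ℕ) < i → S j ⊆ M τ.arr) ?_ ?_
  · exact ⟨hI, subset_rfl, fun j hj => absurd hj (Nat.not_lt_zero j)⟩
  · rintro i hi τ hx hframe ⟨hI, hσ, hS⟩
    obtain ⟨hI', hadd⟩ := hstep ⟨i, hn ▸ hi⟩ τ hx hframe hI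
    obtain ⟨hmono, hnew⟩ := Set.union_subset_iff.1 hadd
    refine ⟨hI', hσ.trans hmono, fun j hj => ?_⟩
    rcases Nat.lt_succ_iff_lt_or_eq.1 hj with hlt | rfl
    · exact (hS j hlt).trans hmono
    · exact hnew

end ForProg

end ForPrograms

section Distances

variable {V : Type*} {G : SimpleGraph V}

theorem exists_adj_dist_eq_of_dist_eq_add_one (hG : G.Preconnected) {s v : V} {r : ℕ}
    (h : G.dist s v = r + 1) : ∃ u, G.Adj u v ∧ G.dist s u = r := by
  obtain ⟨P, hP⟩ := (hG v s).exists_walk_length_eq_dist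
  rw [SimpleGraph.dist_comm, h] at hP
  cases P with
  | nil => simp at hP
  | cons hvu P =>
    rw [SimpleGraph.Walk.length_cons, Nat.add_right_cancel_iff] at hP
    have hle := SimpleGraph.dist_comm (G := G) ▸ SimpleGraph.dist_le P
    have hge := dist_le_dist_add_one_of_adj hG hvu s
    exact ⟨_, hvu.symm, by omega⟩

theorem dist_lt_card_of_preconnected [Fintype V] (hG : G.Preconnected) (s v : V) :
    G.dist s v < Fintype.card V := by
  obtain ⟨P, hpath, hP⟩ := (hG s v).exists_path_of_dist
  exact hP ▸ hpath.length_lt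

namespace ForProg

/-- Marks the vertex `v` at distance `r + 1` from `s` if the vertex `u` at distance `r` is adjacent
to it. The variables `3`, `4`, `5`, `6` hold `r`, `s`, `u`, `v`. -/
def markNeighbor : ForProg :=
  .ifThen (.and (.get 0 (.var 5) (.var 6))
      (.and (.eq (.get 2 (.var 4) (.var 5)) (.add (.var 3) (.const 1)))
        (.not (.get 2 (.var 4) (.var 6)))))
    (.store 2 (.var 4) (.var 6) (.add (.var 3) (.const 2)))

/-- Stores in array `2` the distances plus one, by a breadth-first search from all vertices
simultaneously. -/
def distProg : ForProg :=
  .seq (.forAll 3 (.store 2 (.var 3) (.var 3) (.const 1)))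
    (.forAll 3 (.forAll 4 (.forAll 5 (.forAll 6 markNeighbor))))

end ForProg

variable {n : ℕ} {G : SimpleGraph (Fin n)} {r : ℕ}

/-- The state of the breadth-first search when all vertices within distance `r` are marked. The
marks are the distances plus one, as `0` stands for an unmarked vertex. -/
def IsDistUpTo (G : SimpleGraph (Fin n)) (r : ℕ) (D : ℕ → ℕ → ℕ) : Prop :=
  ∀ s v : Fin n, D s v = 0 ∧ r < G.dist s v ∨ D s v = G.dist s v + 1

/-- The pairs of vertices whose entry in the array `a` is not `0`. -/
def entries (n a : ℕ) (A : ℕ → ℕ → ℕ → ℕ) : Set (Fin n × Fin n) :=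
  {q | A a q.1 q.2 ≠ 0}

theorem entries_subset_of_setArr {σ : Store} {a i j m : ℕ} (hm : m ≠ 0) :
    entries n a σ.arr ⊆ entries n a (σ.setArr a i j m).arr := by
  intro q hq
  simp only [entries, Set.mem_ofPred_eq, Store.setArr_arr_self] at hq ⊢
  split_ifs
  · exact hm
  · exact hq

namespace ForProg

theorem adds_markNeighbor (hG : G.Preconnected) {r : ℕ} {s u v : Fin n} {τ : Store}
    (hA : ∀ u v : Fin n, τ.arr 0 u v ≠ 0 ↔ G.Adj u v)
    (h3 : τ.var 3 = r) (h4 : τ.var 4 = s) (h5 : τ.var 5 = u) (h6 : τ.var 6 = v) :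
    markNeighbor.Adds (fun A => IsDistUpTo G r (A 2)) (entries n 2) τ
      {q | G.Adj u v ∧ G.dist s u = r ∧ q = (s, v)} := by
  have hcond : (Expr.and (.get 0 (.var 5) (.var 6))
      (.and (.eq (.get 2 (.var 4) (.var 5)) (.add (.var 3) (.const 1)))
        (.not (.get 2 (.var 4) (.var 6))))).eval τ ≠ 0 ↔
      G.Adj u v ∧ τ.arr 2 s u = r + 1 ∧ τ.arr 2 s v = 0 := by
    rw [Expr.eval_and_ne_zero, Expr.eval_and_ne_zero, Expr.eval_eq_ne_zero, Expr.eval_not_ne_zero]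
    simp only [Expr.eval, h3, h4, h5, h6, hA]
  refine adds_ifThen (fun h hD => ?_) (fun hD h => ?_)
  · obtain ⟨huv, hu, hv⟩ := hcond.1 h
    have hdu : G.dist s u = r := by
      have := hD s u
      omega
    have hdv : G.dist s v = r + 1 := by
      have := hD s v
      have := dist_le_dist_add_one_of_adj hG huv.symm s
      omega
    simp only [exec, Expr.eval, h3, h4, h6]
    refine ⟨fun s' v' => ?_, Set.union_subset (entries_subset_of_setArr (by omega)) ?_⟩
    · rw [Store.setArr_arr_self]
      split_ifs with h
      · right
        rw [Fin.ext h.1, Fin.ext h.2, hdv]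
      · exact hD s' v'
    · rintro _ ⟨-, -, rfl⟩
      simp [entries, Store.setArr_arr_self]
  · rintro _ ⟨huv, hdu, rfl⟩ hv
    refine h (hcond.2 ⟨huv, ?_, hv⟩)
    have := hD s u
    omega

theorem isDistUpTo_add_one_of_entries_subset (hG : G.Preconnected) {A : ℕ → ℕ → ℕ → ℕ}
    (hD : IsDistUpTo G r (A 2))
    (hmark : ⋃ s, ⋃ u, ⋃ v, {q | G.Adj u v ∧ G.dist s u = r ∧ q = (s, v)} ⊆ entries n 2 A) :
    IsDistUpTo G (r + 1) (A 2) := by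
  intro s v
  rcases hD s v with ⟨hv, hr⟩ | hv
  · refine .inl ⟨hv, lt_of_le_of_ne hr fun heq => ?_⟩
    obtain ⟨u, huv, hu⟩ := exists_adj_dist_eq_of_dist_eq_add_one hG heq.symm
    exact hmark (Set.mem_iUnion.2 ⟨s, Set.mem_iUnion.2 ⟨u, Set.mem_iUnion.2 ⟨v, huv, hu, rfl⟩⟩⟩) hv
  · exact .inr hv

theorem isDistUpTo_exec_round (hG : G.Preconnected) {σ : Store} (hn : σ.var 0 = n)
    (hA : ∀ u v : Fin n, σ.arr 0 u v ≠ 0 ↔ G.Adj u v) (h3 : σ.var 3 = r)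
    (hD : IsDistUpTo G r (σ.arr 2)) :
    IsDistUpTo G (r + 1) (((forAll 4 (forAll 5 (forAll 6 markNeighbor))).exec σ).arr 2) := by
  have hadds : (forAll 4 (forAll 5 (forAll 6 markNeighbor))).Adds
      (fun A => IsDistUpTo G r (A 2)) (entries n 2) σ
      (⋃ s, ⋃ u, ⋃ v, {q | G.Adj u v ∧ G.dist s u = r ∧ q = (s, v)}) := by
    refine adds_forAll (by decide) hn fun s σ₁ h4 hf₁ => ?_
    have hn₁ := (hf₁.1 0 (by decide)).trans hn
    refine adds_forAll (by decide) hn₁ fun u σ₂ h5 hf₂ => ?_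
    have hn₂ := (hf₂.1 0 (by decide)).trans hn₁
    refine adds_forAll (by decide) hn₂ fun v σ₃ h6 hf₃ => ?_
    refine adds_markNeighbor hG ?_ ?_ ?_ ?_ h6
    · rwa [hf₃.2 0 (by decide), hf₂.2 0 (by decide), hf₁.2 0 (by decide)]
    · rwa [hf₃.1 3 (by decide), hf₂.1 3 (by decide), hf₁.1 3 (by decide)]
    · rwa [hf₃.1 4 (by decide), hf₂.1 4 (by decide)]
    · rwa [hf₃.1 5 (by decide)]
  obtain ⟨hD', hmark⟩ := hadds hD
  exact isDistUpTo_add_one_of_entries_subset hG hD' (Set.union_subset_iff.1 hmark).2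

theorem isDistUpTo_zero_exec_forAll {σ : Store} (hn : σ.var 0 = n)
    (hD : ∀ s v : Fin n, σ.arr 2 s v = 0) (hG : G.Preconnected) :
    IsDistUpTo G 0 (((forAll 3 (.store 2 (.var 3) (.var 3) (.const 1))).exec σ).arr 2) := by
  have hadds : (forAll 3 (.store 2 (.var 3) (.var 3) (.const 1))).Adds
      (fun A => ∀ s v : Fin n, s ≠ v → A 2 s v = 0) (fun A => {v : Fin n | A 2 v v = 1}) σ
      (⋃ v, {v}) := by
    refine adds_forAll (by decide) hn fun u τ h3 _ hI => ?_
    simp only [exec, Expr.eval, h3]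
    refine ⟨fun s v hsv => ?_, Set.union_subset (fun v hv => ?_) ?_⟩
    · rw [Store.setArr_arr_self, if_neg fun h => hsv (Fin.ext (h.1.trans h.2.symm)), hI s v hsv]
    · rw [Set.mem_ofPred_eq, Store.setArr_arr_self]
      split_ifs
      exacts [rfl, hv]
    · rintro _ rfl
      simp [Store.setArr_arr_self]
  obtain ⟨hoff, hdiag⟩ := hadds fun s v _ => hD s v
  intro s v
  rcases eq_or_ne s v with rfl | hsv
  · exact .inr ((hdiag (.inr (Set.mem_iUnion.2 ⟨s, rfl⟩))).trans (by rw [SimpleGraph.dist_self]))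
  · exact .inl ⟨hoff s v hsv, (hG s v).pos_dist_of_ne hsv⟩

theorem exec_distProg_arr (hG : G.Preconnected) {σ : Store} (hn : σ.var 0 = n)
    (hA : ∀ u v : Fin n, σ.arr 0 u v ≠ 0 ↔ G.Adj u v) (hD : ∀ s v : Fin n, σ.arr 2 s v = 0)
    (s v : Fin n) : (distProg.exec σ).arr 2 s v = G.dist s v + 1 := by
  have hinit := isDistUpTo_zero_exec_forAll hn hD hG
  have hf := frame_exec (forAll 3 (.store 2 (.var 3) (.var 3) (.const 1))) σ
  rw [distProg, exec]
  set τ := (forAll 3 (.store 2 (.var 3) (.var 3) (.const 1))).exec σ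
  have hn' : τ.var 0 = n := (hf.1 0 (by decide)).trans hn
  have hrounds := exec_forAll_induction (σ := τ) (x := 3) (by decide)
    (fun r ρ => IsDistUpTo G r (ρ.arr 2)) hinit fun r _ ρ h3 hf' hD =>
      isDistUpTo_exec_round hG ((hf'.1 0 (by decide)).trans hn')
        (by rwa [hf'.2 0 (by decide), hf.2 0 (by decide)]) h3 hD
  have hlt := dist_lt_card_of_preconnected hG s v
  rw [Fintype.card_fin] at hlt
  rw [hn'] at hrounds
  rcases hrounds s v with h | h
  · exact absurd h.2 hlt.asymm
  · exact h

end ForProg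

end Distances

section Sides

namespace ForProg

/-- Stores in variable `1` the square root of the number of vertices if this number is a square.
Variable `2` holds the square of variable `1`. -/
def sqrtProg : ForProg :=
  .forAll 3 <| .ifThen (.lt (.var 2) (.var 0)) <|
    .seq (.assign 2 (.add (.var 2) (.add (.add (.var 1) (.var 1)) (.const 1))))
      (.assign 1 (.add (.var 1) (.const 1)))

/-- The distance of the vertices in the variables `x` and `y`, read off array `2`. -/
def distExpr (x y : ℕ) : Expr :=
  .sub (.get 2 (.var x) (.var y)) (.const 1)

/-- Marks in column `0` of array `4` the corners of the grid. -/
def cornerProg : ForProg :=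
  .forAll 3 <| .forAll 4 <|
    .ifThen (.eq (.add (distExpr 3 4) (.const 2)) (.add (.var 1) (.var 1)))
      (.store 4 (.var 3) (.const 0) (.const 1))

/-- The condition that the vertices in variables `3` and `4` are the ends of a side. -/
def sideExpr : Expr :=
  .and (.and (.get 4 (.var 3) (.const 0)) (.get 4 (.var 4) (.const 0)))
    (.eq (.add (distExpr 3 4) (.const 1)) (.var 1))

/-- The first coordinate of the vertex in variable `5` with respect to the side whose ends are in
the variables `3` and `4`. -/
def fstCoordExpr : Expr :=
  .half (.sub (.add (distExpr 3 5) (.sub (.var 1) (.const 1))) (distExpr 4 5))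

/-- The second coordinate of the vertex in variable `5` with respect to the side whose ends are in
the variables `3` and `4`. -/
def sndCoordExpr : Expr :=
  .half (.sub (.add (distExpr 3 5) (distExpr 4 5)) (.sub (.var 1) (.const 1)))

/-- Stores in rows `0` and `1` of array `3` the coordinates of all vertices with respect to the side
whose ends are in the variables `3` and `4`. -/
def sideCoordProg : ForProg :=
  .forAll 5 <| .seq (.store 3 (.const 0) (.var 5) fstCoordExpr)
    (.store 3 (.const 1) (.var 5) sndCoordExpr)

/-- Stores in rows `0` and `1` of array `3` the coordinates of all vertices with respect to some
side. -/
def coordProg : ForProg :=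
  .forAll 3 (.forAll 4 (.ifThen sideExpr sideCoordProg))

theorem exec_sqrtProg_var {σ : Store} {k : ℕ} (hn : σ.var 0 = k * k) (h1 : σ.var 1 = 0)
    (h2 : σ.var 2 = 0) : (sqrtProg.exec σ).var 1 = k := by
  have h := exec_forAll_induction (σ := σ) (x := 3) (p := .ifThen (.lt (.var 2) (.var 0)) <|
      .seq (.assign 2 (.add (.var 2) (.add (.add (.var 1) (.var 1)) (.const 1))))
        (.assign 1 (.add (.var 1) (.const 1)))) (by decide)
    (fun i τ => τ.var 1 = min i k ∧ τ.var 2 = τ.var 1 * τ.var 1) ?_ ?_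
  · exact h.1.trans (min_eq_right (hn ▸ Nat.le_mul_self k))
  · simp [Store.setVar, h1, h2]
  · rintro i - τ - hf ⟨h1, h2⟩
    have h0 : τ.var 0 = k * k := (hf.1 0 (by decide)).trans hn
    have hlt : (Expr.lt (.var 2) (.var 0)).eval τ ≠ 0 ↔ τ.var 1 < k := by
      rw [Expr.eval_lt_ne_zero, Expr.eval, Expr.eval, h0, h2, Nat.mul_self_lt_mul_self_iff]
    rw [exec]
    split_ifs with h
    · have := hlt.1 h
      simp only [exec, Expr.eval, Store.setVar, h2]
      simp only [Nat.reduceEqDiff, OfNat.one_ne_ofNat, OfNat.ofNat_ne_one, ↓reduceIte]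
      exact ⟨by omega, by ring⟩
    · have := hlt.not.1 h
      refine ⟨?_, h2⟩
      rw [Store.setVar_var_of_ne (by decide)]
      omega

variable {n k : ℕ} {G : SimpleGraph (Fin n)} {σ τ : Store}

/-- The memory after the computation of the side length `k` and of the distances in `G`. -/
structure HasDist (G : SimpleGraph (Fin n)) (k : ℕ) (σ : Store) : Prop where
  var_zero : σ.var 0 = n
  var_one : σ.var 1 = k
  arr_two (s v : Fin n) : σ.arr 2 s v = G.dist s v + 1

theorem HasDist.of_frame {p : ForProg} (h : HasDist G k σ) (hf : p.Frame σ τ) (h0 : 0 ∉ p.vars)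
    (h1 : 1 ∉ p.vars) (h2 : 2 ∉ p.arrs) : HasDist G k τ :=
  ⟨(hf.1 0 h0).trans h.var_zero, (hf.1 1 h1).trans h.var_one, by rw [hf.2 2 h2]; exact h.arr_two⟩

theorem HasDist.eval_distExpr (h : HasDist G k σ) {x y : ℕ} {s v : Fin n} (hx : σ.var x = s)
    (hy : σ.var y = v) : (distExpr x y).eval σ = G.dist s v := by
  simp only [distExpr, Expr.eval, hx, hy, h.arr_two, Nat.add_sub_cancel]

theorem adds_cornerProg_body (h : HasDist G k σ) {p w : Fin n} (hp : σ.var 3 = p)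
    (hw : σ.var 4 = w) :
    (ifThen (.eq (.add (distExpr 3 4) (.const 2)) (.add (.var 1) (.var 1)))
      (.store 4 (.var 3) (.const 0) (.const 1))).Adds
      (fun A => ∀ p : Fin n, A 4 p 0 ≠ 0 → IsCorner G k p) (fun A => {p : Fin n | A 4 p 0 ≠ 0}) σ
      {p' | G.dist p w + 2 = k + k ∧ p' = p} := by
  have hcond : (Expr.eq (.add (distExpr 3 4) (.const 2)) (.add (.var 1) (.var 1))).eval σ ≠ 0 ↔
      G.dist p w + 2 = k + k := by
    rw [Expr.eval_eq_ne_zero]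
    simp only [Expr.eval, h.eval_distExpr hp hw, h.var_one]
  refine adds_ifThen (fun h hI => ?_) ?_
  · have hpw := hcond.1 h
    simp only [exec, Expr.eval, hp]
    refine ⟨fun p' hp' => ?_, Set.union_subset (fun p' hp' => ?_) ?_⟩
    · rw [Store.setArr_arr_self] at hp'
      split_ifs at hp' with heq
      · exact Fin.ext heq.1 ▸ ⟨w, hpw⟩
      · exact hI p' hp'
    · rw [Set.mem_ofPred_eq, Store.setArr_arr_self]
      split_ifs
      exacts [one_ne_zero, hp']
    · rintro _ ⟨-, rfl⟩
      simp [Store.setArr_arr_self]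
  · rintro - h _ ⟨hpw, -⟩
    exact absurd (hcond.2 hpw) h

theorem exec_cornerProg_arr (h : HasDist G k σ) (h4 : ∀ p : Fin n, σ.arr 4 p 0 = 0)
    (p : Fin n) : (cornerProg.exec σ).arr 4 p 0 ≠ 0 ↔ IsCorner G k p := by
  have hadds : cornerProg.Adds (fun A => ∀ p : Fin n, A 4 p 0 ≠ 0 → IsCorner G k p)
      (fun A => {p : Fin n | A 4 p 0 ≠ 0}) σ
      (⋃ p, ⋃ w, {p' | G.dist p w + 2 = k + k ∧ p' = p}) := by
    refine adds_forAll (by decide) h.var_zero fun p σ₁ hp hf₁ => ?_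
    have h₁ := h.of_frame hf₁ (by decide) (by decide) (by decide)
    refine adds_forAll (by decide) h₁.var_zero fun w σ₂ hw hf₂ => ?_
    have h₂ := h₁.of_frame hf₂ (by decide) (by decide) (by decide)
    exact adds_cornerProg_body h₂ ((hf₂.1 3 (by decide)).trans hp) hw
  obtain ⟨hI, hsub⟩ := hadds fun p hp => absurd (h4 p) hp
  exact ⟨hI p, fun ⟨w, hw⟩ =>
    hsub (.inr (Set.mem_iUnion.2 ⟨p, Set.mem_iUnion.2 ⟨w, hw, rfl⟩⟩))⟩

theorem HasDist.eval_coordExprs (h : HasDist G k σ) {p q v : Fin n} (hp : σ.var 3 = p)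
    (hq : σ.var 4 = q) (hv : σ.var 5 = v) :
    (fstCoordExpr.eval σ, sndCoordExpr.eval σ) = sideCoord G k p q v := by
  simp only [fstCoordExpr, sndCoordExpr, Expr.eval, h.eval_distExpr hp hv, h.eval_distExpr hq hv,
    h.var_one, sideCoord, gridCoord]

theorem exec_sideCoordProg_arr (h : HasDist G k σ) {p q : Fin n} (hp : σ.var 3 = p)
    (hq : σ.var 4 = q) (v : Fin n) :
    ((sideCoordProg.exec σ).arr 3 0 v, (sideCoordProg.exec σ).arr 3 1 v) =
      sideCoord G k p q v := by
  have hadds : sideCoordProg.Adds (fun _ => True)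
      (fun A => {v : Fin n | (A 3 0 v, A 3 1 v) = sideCoord G k p q v}) σ (⋃ v, {v}) := by
    refine adds_forAll (by decide) h.var_zero fun v τ hv hf => ?_
    have hτ := h.of_frame hf (by decide) (by decide) (by decide)
    have hcoord (ρ : Store) (hρ : HasDist G k ρ) (hvar : ρ.var = τ.var) :
        (fstCoordExpr.eval ρ, sndCoordExpr.eval ρ) = sideCoord G k p q v :=
      hρ.eval_coordExprs (hvar ▸ (hf.1 3 (by decide)).trans hp)
        (hvar ▸ (hf.1 4 (by decide)).trans hq) (hvar ▸ hv)
    have hfst : fstCoordExpr.eval τ = (sideCoord G k p q v).1 :=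
      congrArg Prod.fst (hcoord τ hτ rfl)
    have hsnd := congrArg Prod.snd (hcoord ((store 3 (.const 0) (.var 5) fstCoordExpr).exec τ)
      (hτ.of_frame (frame_exec _ τ) (by decide) (by decide) (by decide)) rfl)
    refine fun _ => ⟨trivial, fun v' hv' => ?_⟩
    simp only [Set.mem_ofPred_eq, exec, Expr.eval, hv] at hsnd ⊢
    rw [hsnd, hfst]
    rcases eq_or_ne v' v with rfl | hne
    · simp [Store.setArr, hv]
    · simpa [Store.setArr, hv, Fin.val_ne_of_ne hne, hne] using hv'
  exact (hadds trivial).2 (.inr (Set.mem_iUnion.2 ⟨v, rfl⟩))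

theorem eval_sideExpr_ne_zero (h : HasDist G k σ)
    (hC : ∀ p : Fin n, σ.arr 4 p 0 ≠ 0 ↔ IsCorner G k p) {p q : Fin n} (hp : σ.var 3 = p)
    (hq : σ.var 4 = q) : sideExpr.eval σ ≠ 0 ↔ IsSide G k p q := by
  simp only [sideExpr, Expr.eval_and_ne_zero, Expr.eval_eq_ne_zero]
  simp only [Expr.eval, h.eval_distExpr hp hq, hp, hq, h.var_one, hC, IsSide, and_assoc]

theorem exists_isSide_exec_coordProg_arr (h : HasDist G k σ)
    (hC : ∀ p : Fin n, σ.arr 4 p 0 ≠ 0 ↔ IsCorner G k p) (hside : ∃ p q, IsSide G k p q) :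
    ∃ p q, IsSide G k p q ∧ ∀ v : Fin n,
      ((coordProg.exec σ).arr 3 0 v, (coordProg.exec σ).arr 3 1 v) = sideCoord G k p q v := by
  have hadds : coordProg.Adds (fun _ => True) (fun A => {_u : Unit | ∃ p q, IsSide G k p q ∧
      ∀ v : Fin n, (A 3 0 v, A 3 1 v) = sideCoord G k p q v}) σ
      (⋃ p, ⋃ q, {_u | IsSide G k p q}) := by
    refine adds_forAll (by decide) h.var_zero fun p σ₁ hp hf₁ => ?_
    have h₁ := h.of_frame hf₁ (by decide) (by decide) (by decide)
    refine adds_forAll (by decide) h₁.var_zero fun q σ₂ hq hf₂ => ?_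
    have h₂ := h₁.of_frame hf₂ (by decide) (by decide) (by decide)
    have hp₂ := (hf₂.1 3 (by decide)).trans hp
    have hcond := eval_sideExpr_ne_zero h₂
      (by rwa [hf₂.2 4 (by decide), hf₁.2 4 (by decide)]) hp₂ hq
    refine adds_ifThen (fun h _ => ⟨trivial, fun _ _ => ?_⟩)
      (fun _ h _ hpq => absurd (hcond.2 hpq) h)
    exact ⟨p, q, hcond.1 h, exec_sideCoordProg_arr h₂ hp₂ hq⟩
  obtain ⟨p, q, hpq⟩ := hside
  exact (hadds trivial).2 (Set.mem_union_right _
    (Set.mem_iUnion.2 ⟨p, Set.mem_iUnion.2 ⟨q, show () ∈ {_u : Unit | _} from hpq⟩⟩))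

end ForProg

end Sides

section HubSets

/-- The coordinates of the vertex `v`, stored in rows `0` and `1` of `C`, with row `s` first. -/
def orientedCoord (C : ℕ → ℕ → ℕ) (s v : ℕ) : ℕ × ℕ :=
  (C s v, C (1 - s) v)

theorem swap_orientedCoord {C : ℕ → ℕ → ℕ} {s : ℕ} (hs : s ≤ 1) (v : ℕ) :
    (orientedCoord C s v).swap = orientedCoord C (1 - s) v := by
  rw [orientedCoord, orientedCoord, Nat.sub_sub_self hs, Prod.swap]

/-- The state after `i` rounds of the descent into the part of the dissection whose separator
contains `u`: the rectangle `[a, b) × [c, d)`, where the axis `s` is to be cut next. Until the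
separator is reached, each round decreases `(b - a) + (d - c)`. -/
structure IsDescent (C : ℕ → ℕ → ℕ) (k u i s a b c d : ℕ) : Prop where
  axis_le : s ≤ 1
  isHub_iff (v : ℕ) : IsHub 0 k 0 k (orientedCoord C 0 v) (orientedCoord C 0 u) ↔
    IsHub a b c d (orientedCoord C s v) (orientedCoord C s u)
  fst_mem : C s u ∈ Set.Ico a b
  snd_mem : C (1 - s) u ∈ Set.Ico c d
  progress : C s u = (a + b) / 2 ∨ b + d + i ≤ a + c + 2 * k

namespace IsDescent

variable {C : ℕ → ℕ → ℕ} {k u i s a b c d : ℕ}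

theorem zero (hfst : C 0 u < k) (hsnd : C 1 u < k) : IsDescent C k u 0 0 0 k 0 k :=
  ⟨zero_le_one, fun _ => Iff.rfl, ⟨Nat.zero_le _, hfst⟩, ⟨Nat.zero_le _, hsnd⟩, .inr (by omega)⟩

theorem succ_of_eq (h : IsDescent C k u i s a b c d) (hu : C s u = (a + b) / 2) :
    IsDescent C k u (i + 1) s a b c d :=
  { h with progress := .inl hu }

theorem succ_of_lt (h : IsDescent C k u i s a b c d) (hu : C s u < (a + b) / 2) :
    IsDescent C k u (i + 1) (1 - s) c d a ((a + b) / 2) where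
  axis_le := Nat.sub_le 1 s
  isHub_iff v := by
    rw [h.isHub_iff, isHub_iff_of_lt_mid hu, swap_orientedCoord h.axis_le,
      swap_orientedCoord h.axis_le]
  fst_mem := h.snd_mem
  snd_mem := by
    rw [Nat.sub_sub_self h.axis_le]
    exact ⟨h.fst_mem.1, hu⟩
  progress := by
    obtain ⟨hau, hub⟩ := h.fst_mem
    have := h.progress
    omega

theorem succ_of_gt (h : IsDescent C k u i s a b c d) (hu : (a + b) / 2 < C s u) :
    IsDescent C k u (i + 1) (1 - s) c d ((a + b) / 2 + 1) b where
  axis_le := Nat.sub_le 1 s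
  isHub_iff v := by
    rw [h.isHub_iff, isHub_iff_of_mid_lt hu, swap_orientedCoord h.axis_le,
      swap_orientedCoord h.axis_le]
  fst_mem := h.snd_mem
  snd_mem := by
    rw [Nat.sub_sub_self h.axis_le]
    exact ⟨hu, h.fst_mem.2⟩
  progress := by
    have hub : C s u < b := h.fst_mem.2
    have := h.progress
    omega

theorem eq_mid (h : IsDescent C k u i s a b c d) (hi : 2 * k ≤ i + 1) : C s u = (a + b) / 2 := by
  have := h.fst_mem.1.trans_lt h.fst_mem.2
  have := h.snd_mem.1.trans_lt h.snd_mem.2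
  have := h.progress
  omega

end IsDescent

namespace ForProg

/-- One round of the descent for the vertex `u` in variable `3`. The variables `5`, …, `9` hold
`s`, `a`, `b`, `c`, `d`, and the variables `10`, `11`, `12` are auxiliary. -/
def descendProg : ForProg :=
  .seq (.assign 10 (.half (.add (.var 6) (.var 7)))) <|
  .seq (.assign 11 (.get 3 (.var 5) (.var 3))) <|
  .seq (.ifThen (.lt (.var 11) (.var 10)) (.assign 7 (.var 10))) <|
  .seq (.ifThen (.lt (.var 10) (.var 11)) (.assign 6 (.add (.var 10) (.const 1)))) <|
  .ifThen (.not (.eq (.var 10) (.var 11))) <|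
  .seq (.assign 5 (.sub (.const 1) (.var 5))) <|
  .seq (.assign 12 (.var 6)) <| .seq (.assign 6 (.var 8)) <| .seq (.assign 8 (.var 12)) <|
  .seq (.assign 12 (.var 7)) <| .seq (.assign 7 (.var 9)) (.assign 9 (.var 12))

/-- The condition that the vertex `u` in variable `3` is a hub of the vertex `v` in variable `4`,
after the descent for `u`. -/
def hubExpr : Expr :=
  .and (.and (.not (.lt (.get 3 (.var 5) (.var 4)) (.var 6)))
      (.lt (.get 3 (.var 5) (.var 4)) (.var 7))) <|
  .and (.and (.not (.lt (.get 3 (.sub (.const 1) (.var 5)) (.var 4)) (.var 8)))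
      (.lt (.get 3 (.sub (.const 1) (.var 5)) (.var 4)) (.var 9))) <|
  .not (.and (.eq (.get 3 (.var 5) (.var 4)) (.get 3 (.var 5) (.var 3)))
    (.lt (.get 3 (.sub (.const 1) (.var 5)) (.var 3))
      (.get 3 (.sub (.const 1) (.var 5)) (.var 4))))

/-- Prepares the descent: the rectangle is the whole square `[0, k) × [0, k)`. -/
def resetProg : ForProg :=
  .seq (.assign 5 (.const 0)) <| .seq (.assign 6 (.const 0)) <| .seq (.assign 7 (.var 1)) <|
  .seq (.assign 8 (.const 0)) (.assign 9 (.var 1))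

/-- Stores in column `u` of array `1` which vertices have the hub `u`, after the descent for the
vertex `u` in variable `3`. -/
def writeHubProg : ForProg :=
  .forAll 4 (.store 1 (.var 4) (.var 3) hubExpr)

/-- Stores in array `1` the labels for the coordinates in array `3`. -/
def hubProg : ForProg :=
  .forAll 3 <| .seq resetProg <| .seq (.forAll 4 descendProg) writeHubProg

/-- The state of the descent, in the variables of `σ`. -/
abbrev IsDescentAt (k u i : ℕ) (σ : Store) : Prop :=
  IsDescent (σ.arr 3) k u i (σ.var 5) (σ.var 6) (σ.var 7) (σ.var 8) (σ.var 9)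

variable {k u i v : ℕ} {σ : Store}

theorem isDescentAt_exec_descendProg (h3 : σ.var 3 = u) (h : IsDescentAt k u i σ) (m : ℕ) :
    IsDescentAt k u (i + 1) ((descendProg.exec σ).setVar 4 m) := by
  rcases lt_trichotomy (σ.arr 3 (σ.var 5) u) ((σ.var 6 + σ.var 7) / 2) with hu | hu | hu
  · simpa [IsDescentAt, descendProg, exec, Expr.not, Expr.eval, Store.setVar, h3, hu, hu.ne',
      hu.asymm] using h.succ_of_lt hu
  · simpa [IsDescentAt, descendProg, exec, Expr.not, Expr.eval, Store.setVar, h3, hu]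
      using h.succ_of_eq hu
  · simpa [IsDescentAt, descendProg, exec, Expr.not, Expr.eval, Store.setVar, h3, hu, hu.ne,
      hu.asymm] using h.succ_of_gt hu

theorem eval_hubExpr_ne_zero (h3 : σ.var 3 = u) (h4 : σ.var 4 = v) (h : IsDescentAt k u i σ)
    (hi : 2 * k ≤ i + 1) : hubExpr.eval σ ≠ 0 ↔
      IsHub 0 k 0 k (orientedCoord (σ.arr 3) 0 v) (orientedCoord (σ.arr 3) 0 u) := by
  have hnot (e : Expr) : (Expr.not e).eval σ ≠ 0 ↔ ¬ e.eval σ ≠ 0 :=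
    Expr.eval_not_ne_zero.trans not_not.symm
  rw [h.isHub_iff, isHub_iff_of_eq_mid (h.eq_mid hi)]
  simp only [hubExpr, Expr.eval_and_ne_zero, hnot, Expr.eval_lt_ne_zero, Expr.eval_eq_ne_zero]
  simp only [Expr.eval, h3, h4, orientedCoord, Set.mem_Ico, not_lt, not_and, and_assoc]

theorem isDescentAt_exec_forAll (hn : σ.var 0 = k * k) (h3 : σ.var 3 = u)
    (h : IsDescentAt k u 0 σ) : IsDescentAt k u (k * k) ((forAll 4 descendProg).exec σ) := by
  rw [← hn]
  exact exec_forAll_induction (by decide) (IsDescentAt k u) h fun i _ τ _ hf h =>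
    isDescentAt_exec_descendProg ((hf.1 3 (by decide)).trans h3) h (i + 1)

/-- The pairs `(v, u)` for which array `1` tells correctly whether `u` is a hub of `v`. -/
def hubPairs (n k : ℕ) (C : ℕ → ℕ → ℕ) (A : ℕ → ℕ → ℕ → ℕ) : Set (Fin n × Fin n) :=
  {q | A 1 q.1 q.2 ≠ 0 ↔ IsHub 0 k 0 k (orientedCoord C 0 q.1) (orientedCoord C 0 q.2)}

theorem adds_writeHubProg {n : ℕ} {u : Fin n} (hn : σ.var 0 = n) (h3 : σ.var 3 = u)
    (h : IsDescentAt k u i σ) (hi : 2 * k ≤ i + 1) :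
    writeHubProg.Adds (fun _ => True) (hubPairs n k (σ.arr 3)) σ (⋃ v, {(v, u)}) := by
  refine adds_forAll (by decide) hn fun v τ h4 hf => ?_
  have h3' := (hf.1 3 (by decide)).trans h3
  have h' : IsDescentAt k u i τ := by
    simpa only [IsDescentAt, hf.1 5 (by decide), hf.1 6 (by decide), hf.1 7 (by decide),
      hf.1 8 (by decide), hf.1 9 (by decide), hf.2 3 (by decide)] using h
  have hhub := eval_hubExpr_ne_zero h3' h4 h' hi
  rw [hf.2 3 (by decide)] at hhub
  refine fun _ => ⟨trivial, ?_⟩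
  rintro ⟨v', u'⟩ hvu
  simp only [hubPairs, Set.mem_ofPred_eq, exec, Expr.eval, h3', h4, Store.setArr_arr_self]
  split_ifs with heq
  · rwa [heq.1, heq.2]
  · refine hvu.resolve_right fun h => heq ?_
    cases h
    exact ⟨rfl, rfl⟩

theorem exec_hubProg_arr {n : ℕ} (hn : σ.var 0 = n) (hk : σ.var 1 = k) (hnk : n = k * k)
    (hlt : ∀ v : Fin n, σ.arr 3 0 v < k ∧ σ.arr 3 1 v < k) (v u : Fin n) :
    (hubProg.exec σ).arr 1 v u ≠ 0 ↔
      IsHub 0 k 0 k (orientedCoord (σ.arr 3) 0 v) (orientedCoord (σ.arr 3) 0 u) := by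
  have hadds : hubProg.Adds (fun _ => True) (hubPairs n k (σ.arr 3)) σ (⋃ u, ⋃ v, {(v, u)}) := by
    refine adds_forAll (by decide) hn fun u τ h3 hf => ?_
    have hreset : IsDescentAt k u 0 (resetProg.exec τ) := by
      simpa [IsDescentAt, resetProg, exec, Expr.eval, Store.setVar, hf.1 1 (by decide), hk,
        hf.2 3 (by decide)] using IsDescent.zero (hlt u).1 (hlt u).2
    have hrounds : 2 * k ≤ k * k + 1 := by nlinarith [sq_nonneg ((k : ℤ) - 1)]
    have h0 : τ.var 0 = k * k := (hf.1 0 (by decide)).trans (hn.trans hnk)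
    have hdescent := isDescentAt_exec_forAll (σ := resetProg.exec τ) h0 h3 hreset
    have hf' := frame_exec (.seq resetProg (.forAll 4 descendProg)) τ
    have hadds := adds_writeHubProg (n := n) ((hf'.1 0 (by decide)).trans (h0.trans hnk.symm))
      ((hf'.1 3 (by decide)).trans h3) hdescent hrounds
    have harr : ((resetProg.seq (forAll 4 descendProg)).exec τ).arr = τ.arr :=
      funext fun a => hf'.2 a (Finset.notMem_empty a)
    rw [Adds, harr, hf.2 3 (by decide)] at hadds
    exact hadds
  exact (hadds trivial).2 (.inr (Set.mem_iUnion.2 ⟨u, Set.mem_iUnion.2 ⟨v, rfl⟩⟩))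

end ForProg

end HubSets

section Algorithm

namespace ForProg

/-- The program of the theorem, up to the computation of the distances. -/
def initProg : ForProg :=
  .seq sqrtProg distProg

/-- The program of the theorem, up to the computation of the coordinates. -/
def gridProg : ForProg :=
  .seq initProg (.seq cornerProg coordProg)

/-- The program of the theorem. -/
def labelingProg : ForProg :=
  .seq gridProg hubProg

variable {n k : ℕ} {G : SimpleGraph (Fin n)}

theorem inputStore_arr_zero_ne_zero {u v : Fin n} : (inputStore G).arr 0 u v ≠ 0 ↔ G.Adj u v := by
  simp [inputStore]

theorem inputStore_arr_of_ne_zero {a : ℕ} (ha : a ≠ 0) (i j : ℕ) : (inputStore G).arr a i j = 0 :=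
  if_neg fun h => ha h.1

theorem hasDist_exec_initProg (hG : G.Preconnected) (hn : n = k * k) :
    HasDist G k (initProg.exec (inputStore G)) := by
  have hf := frame_exec sqrtProg (inputStore G)
  have hf' := frame_exec distProg (sqrtProg.exec (inputStore G))
  have h0 := hf.1 0 (by decide)
  refine ⟨(hf'.1 0 (by decide)).trans h0, (hf'.1 1 (by decide)).trans ?_, ?_⟩
  · exact exec_sqrtProg_var hn rfl rfl
  · refine exec_distProg_arr hG h0 ?_ ?_
    · rw [hf.2 0 (by decide)]
      exact fun u v => inputStore_arr_zero_ne_zero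
    · rw [hf.2 2 (by decide)]
      exact fun u v => inputStore_arr_of_ne_zero two_ne_zero u v

theorem exists_isSide_exec_gridProg_arr (hG : G.Preconnected) (hn : n = k * k)
    (hside : ∃ p q, IsSide G k p q) : ∃ p q, IsSide G k p q ∧ ∀ v : Fin n,
      orientedCoord ((gridProg.exec (inputStore G)).arr 3) 0 v = sideCoord G k p q v := by
  have hdist := hasDist_exec_initProg hG hn
  have hf := frame_exec initProg (inputStore G)
  refine exists_isSide_exec_coordProg_arr (hdist.of_frame (frame_exec cornerProg _) (by decide)
    (by decide) (by decide)) (exec_cornerProg_arr hdist fun p => ?_) hside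
  rw [hf.2 4 (by decide)]
  exact inputStore_arr_of_ne_zero four_ne_zero p 0

theorem exists_outputLabeling_exec_labelingProg_eq (hG : G.Preconnected) (φ : G ≃g gridGraph k)
    (hn : n = k * k) (hk : 0 < k) : ∃ p q, IsSide G k p q ∧
      outputLabeling n (labelingProg.exec (inputStore G)) =
        dissectionLabeling k (sideCoord G k p q) := by
  obtain ⟨p, q, hpq, hcoord⟩ := exists_isSide_exec_gridProg_arr hG hn (exists_isSide φ hk)
  have hdist := (hasDist_exec_initProg hG hn).of_frame (frame_exec (.seq cornerProg coordProg) _)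
    (by decide) (by decide) (by decide)
  have hlt (v : Fin n) := hcoord v ▸ sideCoord_lt φ hG hpq v
  refine ⟨p, q, hpq, funext fun v => Finset.ext fun u => ?_⟩
  rw [mem_dissectionLabeling, outputLabeling, Finset.mem_filter_univ, ← hcoord v, ← hcoord u]
  exact exec_hubProg_arr hdist.var_zero hdist.var_one hn hlt v u

end ForProg

end Algorithm

end CuHL

theorem mainTheorem12_general :
    ∃ (prog : CuHL.Prog) (T : Polynomial ℕ),
      ∀ (n : ℕ), 0 < n → ∀ G : SimpleGraph (Fin n), CuHL.IsSquareGrid G →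
        ∃ (t : ℕ) (σ : CuHL.Store),
          CuHL.Run prog (CuHL.inputStore G) t σ ∧ t ≤ T.eval n ∧
          CuHL.IsHCuHL G (CuHL.outputLabeling n σ) ∧
          ∀ L : Fin n → Finset (Fin n), CuHL.IsCuHL G L →
            CuHL.avgLabelSize (CuHL.outputLabeling n σ) ≤
              3 / ((2 / 3) * Real.sqrt (2 / 3)) * CuHL.avgLabelSize L := by
  refine ⟨CuHL.ForProg.labelingProg.toProg, CuHL.ForProg.labelingProg.time, ?_⟩
  rintro n hn0 G ⟨k, ⟨φ⟩⟩
  have hn : n = k * k := by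
    simpa using Fintype.card_congr φ.toEquiv
  have hk : 0 < k := Nat.pos_of_ne_zero fun hk => hn0.ne' (by rw [hn, hk])
  have hG : G.Preconnected := φ.symm.preconnected_iff.1 (CuHL.gridGraph_preconnected k)
  obtain ⟨p, q, hpq, hout⟩ :=
    CuHL.ForProg.exists_outputLabeling_exec_labelingProg_eq hG φ hn hk
  obtain ⟨t, ht, hrun⟩ := CuHL.ForProg.exists_run (p := CuHL.ForProg.labelingProg) (by decide)
    (CuHL.inputStore G)
  refine ⟨t, _, hrun, ht, ?_, fun L hL => ?_⟩ <;> rw [hout]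
  · exact CuHL.isHCuHL_dissectionLabeling_sideCoord φ hG hpq
  · exact CuHL.avgLabelSize_dissectionLabeling_sideCoord_le φ hG hpq hL

theorem mainTheorem12 :
    ∃ (prog : CuHL.Prog) (T : Polynomial ℕ),
      ∀ (n : ℕ), 0 < n → ∀ G : SimpleGraph (Fin n), CuHL.IsSquareGrid G →
        ∃ (t : ℕ) (σ : CuHL.Store),
          CuHL.Run prog (CuHL.inputStore G) t σ ∧ t ≤ T.eval n ∧
          CuHL.IsHCuHL G (CuHL.outputLabeling n σ) ∧
          (∀ L : Fin n → Finset (Fin n), CuHL.IsCuHL G L →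
            CuHL.avgLabelSize (CuHL.outputLabeling n σ) ≤
              3 / ((1 / 4) * Real.sqrt (2 / 3)) * CuHL.avgLabelSize L) ∧
          (∀ L : Fin n → Finset (Fin n), CuHL.IsHCuHL G L →
            CuHL.avgLabelSize (CuHL.outputLabeling n σ) ≤
              3 / ((2 / 3) * Real.sqrt (2 / 3)) * CuHL.avgLabelSize L) := by
  obtain ⟨prog, T, h⟩ := mainTheorem12_general
  refine ⟨prog, T, fun n hn G hG => ?_⟩
  obtain ⟨t, σ, hrun, ht, hout, hratio⟩ := h n hn G hG
  refine ⟨t, σ, hrun, ht, hout, fun L hL => (hratio L hL).trans ?_, fun L hL => hratio L hL.1⟩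
  have havg : 0 ≤ CuHL.avgLabelSize L := by unfold CuHL.avgLabelSize; positivity
  exact mul_le_mul_of_nonneg_right (by gcongr ?_ / (?_ * _) <;> norm_num) havg
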